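/- Fix $p\in(0,1)$, put $q=1-p$, and fix a real number $t$. For $n\ge 2$ let $$a_n=(2\log n)^{-1/2},\qquad b_n=(2\log n)^{1/2}-\tfrac12(2\log n)^{-1/2}(\log\log n+\log 4\pi),\qquad x_n(t)=a_nt+b_n.$$ Let $d_1,\dots,d_n$ be the vertex degrees of the random graph $\mathbb G(n,p)$, in which each of the $\binom n2$ possible edges on the vertex set $\{1,\dots,n\}$ is present independently with probability $p$. Let $d_i^*=(d_i-(n-1)p)/\sqrt{(n-1)pq}$ be the normalized degrees, $I_i^{(n)}$ the indicator of the event $\{d_i^*>x_n(t)\}$, $\pi_1^{(n)}=P(I_1^{(n)}=1)$, $W_n=\sum_{i=1}^n I_i^{(n)}$ and $\lambda_n=E(W_n)$. Then, for every fixed integer $k\ge 0$, $$\lim_{n\to\infty}P(W_n=k)=e^{-e^{-t}}\frac{e^{-tk}}{k!}.$$ Moreover $\lambda_n\to e^{-t}$, and the rate of convergence is of order $(\log n)/n$ in the following sense. Let $d_{TV}(\mathcal L(W_n),\mathrm{Poi}(\lambda_n))=\frac12\sum_{k\ge0}|P(W_n=k)-e^{-\lambda_n}\lambda_n^k/k!|$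 denote the total variation distance between the law of $W_n$ and the Poisson distribution with mean $\lambda_n$. For every $n\ge2$, $$d_{TV}(\mathcal L(W_n),\mathrm{Poi}(\lambda_n))\le U_n:=(1-e^{-\lambda_n})\left[\pi_1^{(n)}+\frac{n(n-1)\,\mathrm{Cov}(I_1^{(n)},I_2^{(n)})}{\lambda_n}\right]$$ (with $U_n=0$ if $\lambda_n=0$), and $$U_n\sim\frac{1+2\log n}{n}\,e^{-t}\left(1-e^{-e^{-t}}\right)\qquad(n\to\infty).$$ In particular $d_{TV}(\mathcal L(W_n),\mathrm{Poi}(\lambda_n))=O((\log n)/n)$ as $n\to\infty$. -/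

import Mathlib

open MeasureTheory ProbabilityTheory Filter Asymptotics
open scoped Topology Nat unitInterval

noncomputable section

namespace RandomGraphDegrees

/-- `a_n = (2 log n)^(-1/2)`. -/
def scaleA (n : ℕ) : ℝ := (2 * Real.log n) ^ (-(1 / 2) : ℝ)

/-- `b_n = (2 log n)^(1/2) - (1/2) (2 log n)^(-1/2) (log log n + log 4π)`. -/
def shiftB (n : ℕ) : ℝ :=
  (2 * Real.log n) ^ (1 / 2 : ℝ) -
    1 / 2 * (2 * Real.log n) ^ (-(1 / 2) : ℝ) * (Real.log (Real.log n) + Real.log (4 * Real.pi))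

/-- The threshold `x_n(t) = a_n t + b_n`. -/
def threshold (t : ℝ) (n : ℕ) : ℝ := scaleA n * t + shiftB n

open Classical in
/-- The normalized degree `(d_v - (n-1)p) / ((n-1)p(1-p))^(1/2)` of the vertex `v` of a graph on
`n` vertices. -/
def normalizedDegree (p : I) {n : ℕ} (v : Fin n) (G : SimpleGraph (Fin n)) : ℝ :=
  ((G.degree v : ℝ) - ((n : ℝ) - 1) * p) / √(((n : ℝ) - 1) * p * (1 - p))

open Classical in
/-- The indicator that the normalized degree of `v` exceeds `x_n(t)`. -/
def exceedance (p : I) (t : ℝ) {n : ℕ} (v : Fin n) (G : SimpleGraph (Fin n)) : ℝ :=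
  if threshold t n < normalizedDegree p v G then 1 else 0

open Classical in
/-- `W_n`: the number of vertices whose normalized degree exceeds `x_n(t)`. -/
def exceedanceCount (p : I) (t : ℝ) (n : ℕ) (G : SimpleGraph (Fin n)) : ℕ :=
  (Finset.univ.filter fun v : Fin n => threshold t n < normalizedDegree p v G).card

/-- The probability space `G(n, p)`. -/
abbrev graphMeasure (p : I) (n : ℕ) : Measure (SimpleGraph (Fin n)) :=
  SimpleGraph.binomialRandom (Fin n) p

/-- `π_v`: the probability that the normalized degree of `v` exceeds `x_n(t)`. -/
def exceedanceProb (p : I) (t : ℝ) {n : ℕ} (v : Fin n) : ℝ :=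
  (graphMeasure p n).real {G | threshold t n < normalizedDegree p v G}

/-- `λ_n = E(W_n)`. -/
def meanCount (p : I) (t : ℝ) (n : ℕ) : ℝ :=
  ∫ G, (exceedanceCount p t n G : ℝ) ∂(graphMeasure p n)

/-- The law of `W_n`, a measure on `ℕ`. -/
def countLaw (p : I) (t : ℝ) (n : ℕ) : Measure ℕ :=
  (graphMeasure p n).map (exceedanceCount p t n)

/-- The total variation distance `(1/2) ∑ |μ{k} - ν{k}|` of two probability measures on `ℕ`. -/
def tvDist (μ ν : Measure ℕ) : ℝ := 1 / 2 * ∑' k : ℕ, |μ.real {k} - ν.real {k}|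

/-- The total variation distance between the law of `W_n` and `Poi(λ_n)`. -/
def poissonDistance (p : I) (t : ℝ) (n : ℕ) : ℝ :=
  tvDist (countLaw p t n) (poissonMeasure (meanCount p t n).toNNReal)

/-- For `n ≥ 2`, the Stein-Chen bound
`(1 - exp (-λ_n)) (π_1 + n (n-1) Cov(I_1, I_2) / λ_n)`. There is no second vertex for `n ≤ 1`, and
the values there play no role. -/
def steinChenBound (p : I) (t : ℝ) : ℕ → ℝ
  | 0 => 0
  | 1 => 0
  | m + 2 =>
    (1 - Real.exp (-meanCount p t (m + 2))) *
      (exceedanceProb p t (0 : Fin (m + 2)) +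
        ((m + 2 : ℕ) : ℝ) * (((m + 2 : ℕ) : ℝ) - 1) *
          cov[exceedance p t (0 : Fin (m + 2)), exceedance p t (1 : Fin (m + 2));
            graphMeasure p (m + 2)] / meanCount p t (m + 2))

end RandomGraphDegrees

end

/-! The exceedance indicators are increasing functions of independent edges, hence positively
associated by FKG. For such indicators the Stein-Chen method bounds the Poisson error by
variance-type quantities. Write `W = V_i + I_i`. If `g` solves the Stein equation for a test
function with values in `[0, 1]`, the error `E[λ g(W+1) - W g(W)]` is the sum over `i` of `π_i E
g(W+1) - E[I_i g(V_i+1)]`. The increments of `g` are bounded by `C = (1 - exp (-λ)) / λ`, so `C k +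
g(k+1)` is increasing in `k` and association applies to it. The outcome is `C ∑ (π_i² + Cov(I_i,
V_i))`, which by symmetry of the vertices is `U_n` (`steinChen_of_association`,
`poissonDistance_le_steinChenBound`).

The size of `U_n` needs two asymptotics. For the mean, Stirling's formula gives a local limit
theorem for binomial weights at `N p + y s`, where `s² = N p q`, valid when `y³ = o(√N)`. Beyond
that point consecutive weights have ratio about `1 - y / s`, so the tail is about `s / y` times its
first term. The constants `a_n`, `b_n` are chosen so that `n exp(-x²/2) / (√(2π) x) → exp(-t)`;
together these give `λ_n → exp(-t)`.

For the covariance, two degrees are independent given the edge between their vertices. Thus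
`Cov(I_1, I_2) = p q δ²`, where `δ` is the effect of that edge on the exceedance probability. This
effect is a single binomial weight just below the cutoff, about `(x / s) exp(-t) / n`. Since `x² ~ 2
log n`, the term `n (n-1) Cov / λ_n` is asymptotic to `2 log n exp(-t) / n` and dominates `π_1 ~
exp(-t) / n`. The distance therefore vanishes, and convergence of the means yields the Poisson
limit. -/

namespace RandomGraphDegrees

/-! ### The Stein equation of the Poisson distribution and the increments of its solution -/

section SteinEquation

variable {r : ℝ} {P a : ℕ → ℝ}

/-- The solution of the Stein equation `r * g (k + 1) - k * g k = a k - ∑' i, a i * P i` of the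
distribution `P` on `ℕ`, the Poisson distribution with mean `r`. -/
noncomputable def steinSolution (r : ℝ) (P a : ℕ → ℝ) : ℕ → ℝ
  | 0 => 0
  | k + 1 => (∑ i ∈ Finset.range (k + 1), a i * P i -
      (∑' i, a i * P i) * ∑ i ∈ Finset.range (k + 1), P i) / (r * P k)

/-- By the recurrence, both terms on the left have denominator `P k`, and their numerators are
consecutive partial sums, so only the last summand survives. The value of the solution at `0` is
irrelevant because of the factor `k`. -/
lemma steinSolution_equation (hr : 0 < r) (hP : ∀ k, 0 < P k)
    (hrec : ∀ k : ℕ, ((k : ℝ) + 1) * P (k + 1) = r * P k) (k : ℕ) :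
    r * steinSolution r P a (k + 1) - k * steinSolution r P a k = a k - ∑' i, a i * P i := by
  cases k with
  | zero =>
    have := (hP 0).ne'
    simp only [steinSolution, Finset.sum_range_one, zero_add, Nat.cast_zero, zero_mul, sub_zero]
    field_simp
  | succ k =>
    have h0 := (hP k).ne'
    have h1 := (hP (k + 1)).ne'
    have hk : ((k : ℝ) + 1) ≠ 0 := by positivity
    have hPk : P k = ((k : ℝ) + 1) * P (k + 1) / r := by rw [hrec k]; field_simp
    simp only [steinSolution, Finset.sum_range_succ _ (k + 1)]
    push_cast
    set m := ∑' i, a i * P i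
    set A := ∑ i ∈ Finset.range (k + 1), a i * P i
    set S := ∑ i ∈ Finset.range (k + 1), P i
    have e : r * P k = ((k : ℝ) + 1) * P (k + 1) := (hrec k).symm
    rw [e]
    field_simp
    ring

/-- This symmetry turns the upper bound on increments, applied to the complementary test function,
into the lower bound. -/
lemma steinSolution_one_sub (hsum : HasSum P 1) (ha : Summable fun i => a i * P i) (k : ℕ) :
    steinSolution r P (fun i => 1 - a i) k = -steinSolution r P a k := by
  cases k with
  | zero => simp [steinSolution]
  | succ k =>
    have h : ∑' i, (1 - a i) * P i = 1 - ∑' i, a i * P i := by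
      simp only [sub_mul, one_mul]
      rw [hsum.summable.tsum_sub ha, hsum.tsum_eq]
    simp only [steinSolution, h]
    simp only [sub_mul, one_mul, Finset.sum_sub_distrib]
    rw [← neg_div]
    congr 1
    ring

/-- The increment is linear in `a`. Because the ratios `P (i + 1) / P i` decrease in `i`, the
coefficient of `a i` is nonpositive for every `i` except `k + 1`. The worst case is thus the
indicator of `k + 1`, where the same comparison of ratios gives the bound. -/
lemma steinSolution_succ_sub_le (hr : 0 < r) (hP : ∀ k, 0 < P k)
    (hrec : ∀ k : ℕ, ((k : ℝ) + 1) * P (k + 1) = r * P k) (hsum : HasSum P 1)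
    (ha0 : ∀ k, 0 ≤ a k) (ha1 : ∀ k, a k ≤ 1) (k : ℕ) :
    steinSolution r P a (k + 2) - steinSolution r P a (k + 1) ≤ (1 - P 0) / r := by
  have hsa : Summable fun i => a i * P i :=
    hsum.summable.of_nonneg_of_le (fun i => mul_nonneg (ha0 i) (hP i).le)
      fun i => mul_le_of_le_one_left (hP i).le (ha1 i)
  have hk : (0 : ℝ) < (k : ℝ) + 1 := by positivity
  set ρ := r / ((k : ℝ) + 1) with hρ
  have hρ0 : 0 < ρ := by positivity
  have hstep : ∀ i : ℕ, P (i + 1) = r / ((i : ℝ) + 1) * P i := fun i => by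
    have : ((i : ℝ) + 1) ≠ 0 := by positivity
    rw [div_mul_eq_mul_div, eq_div_iff this, ← hrec i]; ring
  have hPk1 : P (k + 1) = ρ * P k := hstep k
  have htail : ∀ m, ∑ i ∈ Finset.range m, P i + ∑' i, P (i + m) = 1 := fun m => by
    rw [hsum.summable.sum_add_tsum_nat_add, hsum.tsum_eq]
  have h1 := htail (k + 1)
  have h2 := htail (k + 2)
  have h3 := hsa.sum_add_tsum_nat_add (k + 2)
  -- comparison of the lower sums
  have hS : ρ * ∑ i ∈ Finset.range (k + 1), P i ≤ ∑ i ∈ Finset.range (k + 2), P i - P 0 := by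
    rw [Finset.sum_range_succ' _ (k + 1), add_sub_cancel_right, Finset.mul_sum]
    refine Finset.sum_le_sum fun i hi => ?_
    rw [hstep i]
    have : (i : ℝ) ≤ k := by exact_mod_cast Nat.lt_succ_iff.1 (Finset.mem_range.1 hi)
    have := (hP i).le
    rw [hρ]
    gcongr
  -- comparison of the upper sums
  have hT : ∑' i, P (i + (k + 2)) ≤ ρ * ∑' i, P (i + (k + 1)) := by
    rw [← tsum_mul_left]
    refine Summable.tsum_le_tsum (fun i => ?_) ((summable_nat_add_iff _).2 hsum.summable)
      (((summable_nat_add_iff _).2 hsum.summable).mul_left _)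
    have e : i + (k + 2) = i + (k + 1) + 1 := by ring
    rw [e, hstep]
    have := (hP (i + (k + 1))).le
    push_cast
    rw [hρ]
    gcongr
    have : (0 : ℝ) ≤ i := by positivity
    linarith
  have hα : 0 ≤ ∑ i ∈ Finset.range (k + 1), a i * P i :=
    Finset.sum_nonneg fun i _ => mul_nonneg (ha0 i) (hP i).le
  have hγ : 0 ≤ ∑' i, a (i + (k + 2)) * P (i + (k + 2)) :=
    tsum_nonneg fun i => mul_nonneg (ha0 _) (hP _).le
  have hβ0 := mul_nonneg (ha0 (k + 1)) (hP (k + 1)).le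
  have hβ1 := mul_le_of_le_one_left (hP (k + 1)).le (ha1 (k + 1))
  have e1 : r * P k = r * P (k + 1) / ρ := by rw [hPk1]; field_simp
  simp only [steinSolution]
  rw [e1, ← h3]
  have hS0 : 0 ≤ ∑ i ∈ Finset.range (k + 1), P i := Finset.sum_nonneg fun i _ => (hP i).le
  have hT0 : 0 ≤ ∑' i, P (i + (k + 2)) := tsum_nonneg fun i => (hP _).le
  rw [Finset.sum_range_succ _ (k + 1)] at h2 hS ⊢
  rw [Finset.sum_range_succ _ (k + 1)] 
  have hq := hP (k + 1)
  have hp0 := hP 0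
  set α := ∑ i ∈ Finset.range (k + 1), a i * P i
  set β := a (k + 1) * P (k + 1)
  set γ := ∑' i, a (i + (k + 2)) * P (i + (k + 2))
  set S := ∑ i ∈ Finset.range (k + 1), P i
  set T := ∑' i, P (i + (k + 1))
  set T' := ∑' i, P (i + (k + 2))
  set q := P (k + 1)
  rw [div_div_eq_mul_div, ← sub_div, div_le_div_iff₀ (by positivity) hr]
  -- Here `α`, `β`, `γ` collect the indices below, equal to and above `k + 1`; only the coefficient
  -- of `β` can be positive.
  have e2 : (α + β - (α + β + γ) * (S + q) - (α - (α + β + γ) * S) * ρ)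
      = α * (T' - ρ * T) + γ * (ρ * S - (S + q)) + β * (T' + ρ * S) := by
    have hT1 : T = 1 - S := by linarith
    have hT2 : T' = 1 - (S + q) := by linarith
    rw [hT1, hT2]; ring
  have b1 : α * (T' - ρ * T) ≤ 0 := mul_nonpos_of_nonneg_of_nonpos hα (by linarith)
  have b2 : γ * (ρ * S - (S + q)) ≤ 0 := mul_nonpos_of_nonneg_of_nonpos hγ (by linarith)
  have b3 : β * (T' + ρ * S) ≤ q * (1 - P 0) :=
    mul_le_mul hβ1 (by linarith) (by positivity) hq.le
  have : (α + β - (α + β + γ) * (S + q) - (α - (α + β + γ) * S) * ρ) ≤ q * (1 - P 0) := by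
    rw [e2]; linarith
  nlinarith

lemma neg_le_steinSolution_succ_sub (hr : 0 < r) (hP : ∀ k, 0 < P k)
    (hrec : ∀ k : ℕ, ((k : ℝ) + 1) * P (k + 1) = r * P k) (hsum : HasSum P 1)
    (ha0 : ∀ k, 0 ≤ a k) (ha1 : ∀ k, a k ≤ 1) (k : ℕ) :
    -((1 - P 0) / r) ≤ steinSolution r P a (k + 2) - steinSolution r P a (k + 1) := by
  have hsa : Summable fun i => a i * P i :=
    hsum.summable.of_nonneg_of_le (fun i => mul_nonneg (ha0 i) (hP i).le)
      fun i => mul_le_of_le_one_left (hP i).le (ha1 i)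
  have h := steinSolution_succ_sub_le (a := fun i => 1 - a i) hr hP hrec hsum
    (fun i => sub_nonneg.2 (ha1 i)) (fun i => by linarith [ha0 i]) k
  rw [steinSolution_one_sub hsum hsa, steinSolution_one_sub hsum hsa] at h
  linarith

end SteinEquation

/-! ### The Stein-Chen bound under positive association -/

section SteinChen

variable {Ω ι : Type*} [Fintype Ω] [Fintype ι]

/-- The Stein-Chen bound for positively associated indicators, on a finite probability space. -/
theorem steinChen_of_association {w : Ω → ℝ} (hw : ∀ ω, 0 ≤ w ω) (hw1 : ∑ ω, w ω = 1)
    {J : ι → Ω → ℕ} (hJ : ∀ i ω, J i ω ≤ 1) {V : ι → Ω → ℕ} {W : Ω → ℕ}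
    (hV : ∀ i ω, W ω = V i ω + J i ω) (hW : ∀ ω, W ω = ∑ i, J i ω)
    (hassoc : ∀ i, ∀ h : ℕ → ℝ, Monotone h →
      (∑ ω, w ω * J i ω) * ∑ ω, w ω * h (V i ω) ≤ ∑ ω, w ω * (J i ω * h (V i ω)))
    {r : ℝ} (hr : 0 < r) (hmean : r = ∑ i, ∑ ω, w ω * J i ω) {P a : ℕ → ℝ} (hP : ∀ k, 0 < P k)
    (hrec : ∀ k : ℕ, ((k : ℝ) + 1) * P (k + 1) = r * P k) (hsum : HasSum P 1)
    (ha0 : ∀ k, 0 ≤ a k) (ha1 : ∀ k, a k ≤ 1) :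
    ∑ ω, w ω * a (W ω) - ∑' k, a k * P k ≤ (1 - P 0) / r *
      ∑ i, ((∑ ω, w ω * J i ω) ^ 2 +
        (∑ ω, w ω * (J i ω * V i ω) - (∑ ω, w ω * J i ω) * ∑ ω, w ω * V i ω)) := by
  set g := steinSolution r P a with hg
  set C := (1 - P 0) / r with hC
  have hle := fun k => steinSolution_succ_sub_le hr hP hrec hsum ha0 ha1 k
  have hge := fun k => neg_le_steinSolution_succ_sub hr hP hrec hsum ha0 ha1 k
  rw [← hg, ← hC] at hle hge
  -- Association only speaks of monotone functions and `g` need not be monotone; the linear term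
  -- compensates for its decrements, which are at most `C`.
  have hmono : Monotone fun k : ℕ => C * k + g (k + 1) := by
    refine monotone_nat_of_le_succ fun k => ?_
    push_cast
    linarith [hge k]
  have h1 : ∑ ω, w ω * a (W ω) - ∑' k, a k * P k =
      ∑ ω, w ω * (r * g (W ω + 1) - W ω * g (W ω)) := by
    simp only [hg, steinSolution_equation hr hP hrec, mul_sub, Finset.sum_sub_distrib]
    simp only [← Finset.sum_mul, hw1, one_mul]
  have h2 : ∑ ω, w ω * (r * g (W ω + 1) - W ω * g (W ω)) =
      ∑ i, ((∑ ω, w ω * J i ω) * ∑ ω, w ω * g (W ω + 1) -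
        ∑ ω, w ω * (J i ω * g (V i ω + 1))) := by
    rw [Finset.sum_sub_distrib, ← Finset.sum_mul, ← hmean]
    simp only [mul_sub, Finset.sum_sub_distrib]
    congr 1
    · rw [Finset.mul_sum]; exact Finset.sum_congr rfl fun ω _ => by ring
    · rw [Finset.sum_comm]
      refine Finset.sum_congr rfl fun ω _ => ?_
      have : (W ω : ℝ) = ∑ i, (J i ω : ℝ) := by rw [hW ω]; push_cast; rfl
      rw [this, Finset.sum_mul, Finset.mul_sum]
      refine Finset.sum_congr rfl fun i _ => ?_
      rcases Nat.le_one_iff_eq_zero_or_eq_one.1 (hJ i ω) with h | h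
      · simp [h]
      · rw [hV i ω, h]
  rw [h1, h2, Finset.mul_sum]
  refine Finset.sum_le_sum fun i _ => ?_
  have hπ : 0 ≤ ∑ ω, w ω * J i ω := Finset.sum_nonneg fun ω _ => mul_nonneg (hw ω) (by positivity)
  -- `W` and `V i` differ only where `J i = 1`, and there by one step of `g`. After multiplication
  -- by the mean of `J i` this is the source of the squared term.
  have h3 : ∑ ω, w ω * g (W ω + 1) ≤ ∑ ω, w ω * g (V i ω + 1) + C * ∑ ω, w ω * J i ω := by
    rw [Finset.mul_sum, ← Finset.sum_add_distrib]
    refine Finset.sum_le_sum fun ω _ => ?_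
    rcases Nat.le_one_iff_eq_zero_or_eq_one.1 (hJ i ω) with h | h
    · simp [hV i ω, h]
    · rw [hV i ω, h]
      have := mul_le_mul_of_nonneg_left (hle (V i ω)) (hw ω)
      push_cast
      linarith
  have h4 := hassoc i _ hmono
  have h5 : ∑ ω, w ω * (C * V i ω + g (V i ω + 1)) =
      C * ∑ ω, w ω * V i ω + ∑ ω, w ω * g (V i ω + 1) := by
    rw [Finset.mul_sum, ← Finset.sum_add_distrib]
    exact Finset.sum_congr rfl fun ω _ => by ring
  have h6 : ∑ ω, w ω * (J i ω * (C * V i ω + g (V i ω + 1))) =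
      C * ∑ ω, w ω * (J i ω * V i ω) + ∑ ω, w ω * (J i ω * g (V i ω + 1)) := by
    rw [Finset.mul_sum, ← Finset.sum_add_distrib]
    exact Finset.sum_congr rfl fun ω _ => by ring
  rw [h5, h6] at h4
  have h7 := mul_le_mul_of_nonneg_left h3 hπ
  nlinarith

end SteinChen

/-! ### Random subsets and binomial expectations -/

section RandomSubset

variable {α : Type*}

/-- The expectation of `f S` for the random subset `S` of `D` which contains each element of `D`
independently with probability `p`. -/
noncomputable def subsetMean (p : ℝ) (D : Finset α) (f : Finset α → ℝ) : ℝ :=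
  ∑ s ∈ D.powerset, p ^ s.card * (1 - p) ^ (D.card - s.card) * f s

/-- The weight of `k` under the binomial distribution with parameters `n` and `p`. -/
noncomputable def binomialWeight (p : ℝ) (n k : ℕ) : ℝ := n.choose k * p ^ k * (1 - p) ^ (n - k)

/-- The expectation of `F X` for a binomial random variable `X` with parameters `n` and `p`. -/
noncomputable def binomialMean (p : ℝ) (n : ℕ) (F : ℕ → ℝ) : ℝ :=
  ∑ k ∈ Finset.range (n + 1), binomialWeight p n k * F k

lemma subsetMean_congr {p : ℝ} {D : Finset α} {f g : Finset α → ℝ} (h : ∀ s ⊆ D, f s = g s) :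
    subsetMean p D f = subsetMean p D g :=
  Finset.sum_congr rfl fun s hs => by rw [h s (Finset.mem_powerset.1 hs)]

lemma subsetMean_const_mul (p : ℝ) (D : Finset α) (f : Finset α → ℝ) (c : ℝ) :
    subsetMean p D (fun s => c * f s) = c * subsetMean p D f := by
  rw [subsetMean, subsetMean, Finset.mul_sum]
  exact Finset.sum_congr rfl fun s _ => by ring

lemma subsetMean_mul_const (p : ℝ) (D : Finset α) (f : Finset α → ℝ) (c : ℝ) :
    subsetMean p D (fun s => f s * c) = subsetMean p D f * c := by
  rw [subsetMean, subsetMean, Finset.sum_mul]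
  exact Finset.sum_congr rfl fun s _ => by ring

lemma subsetMean_insert [DecidableEq α] (p : ℝ) {D : Finset α} {x : α} (hx : x ∉ D) (f : Finset α → ℝ) :
    subsetMean p (insert x D) f =
      p * subsetMean p D (fun s => f (insert x s)) + (1 - p) * subsetMean p D f := by
  rw [subsetMean, Finset.sum_powerset_insert hx, add_comm, subsetMean, subsetMean,
    Finset.mul_sum, Finset.mul_sum]
  congr 1
  · refine Finset.sum_congr rfl fun s hs => ?_
    have hxs : x ∉ s := fun h => hx (Finset.mem_powerset.1 hs h)
    rw [Finset.card_insert_of_notMem hx, Finset.card_insert_of_notMem hxs, Nat.add_sub_add_right]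
    ring
  · refine Finset.sum_congr rfl fun s hs => ?_
    have := Finset.card_le_card (Finset.mem_powerset.1 hs)
    rw [Finset.card_insert_of_notMem hx, Nat.sub_add_comm this]
    ring

/-- Independence of disjoint blocks, in the form of Fubini; the induction reveals one element of `A`
at a time. -/
lemma subsetMean_union [DecidableEq α] (p : ℝ) {A B : Finset α} (h : Disjoint A B) (f : Finset α → ℝ) :
    subsetMean p (A ∪ B) f = subsetMean p A fun a => subsetMean p B fun b => f (a ∪ b) := by
  induction A using Finset.induction_on generalizing f with
  | empty => simp [subsetMean]
  | insert x A hx ih =>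
    rw [Finset.disjoint_insert_left] at h
    rw [Finset.insert_union, subsetMean_insert p (by simp [hx, h.1]), subsetMean_insert p hx,
      ih h.2, ih h.2]
    simp only [Finset.insert_union]

lemma subsetMean_card (p : ℝ) (D : Finset α) (F : ℕ → ℝ) :
    subsetMean p D (fun s => F s.card) = binomialMean p D.card F := by
  rw [subsetMean, Finset.sum_powerset_apply_card (fun k => p ^ k * (1 - p) ^ (D.card - k) * F k),
    binomialMean]
  exact Finset.sum_congr rfl fun k _ => by rw [binomialWeight, nsmul_eq_mul]; ring

lemma binomialMean_one (p : ℝ) (n : ℕ) : binomialMean p n (fun _ => 1) = 1 := by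
  have := add_pow p (1 - p) n
  rw [add_sub_cancel, one_pow] at this
  rw [binomialMean]
  refine Eq.trans (Finset.sum_congr rfl fun k _ => ?_) this.symm
  rw [binomialWeight]
  ring

lemma subsetMean_one (p : ℝ) (D : Finset α) : subsetMean p D (fun _ => 1) = 1 := by
  rw [subsetMean_card p D fun _ => 1, binomialMean_one]

/-- Condition on the last trial: the binomial variable is realized as the size of a random subset,
so that revealing one element does the work of Pascal's rule. -/
lemma binomialMean_succ (p : ℝ) (n : ℕ) (F : ℕ → ℝ) :
    binomialMean p (n + 1) F =
      p * binomialMean p n (fun k => F (k + 1)) + (1 - p) * binomialMean p n F := by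
  have h := subsetMean_insert p (D := Finset.range n) (x := n) (by simp) fun s => F s.card
  rw [subsetMean_card, Finset.card_insert_of_notMem (by simp), subsetMean_card,
    Finset.card_range] at h
  rw [h]
  congr 2
  have h2 := subsetMean_card p (Finset.range n) fun k => F (k + 1)
  rw [Finset.card_range] at h2
  rw [← h2]
  refine subsetMean_congr fun s hs => ?_
  rw [Finset.card_insert_of_notMem fun hn => by simpa using hs hn]

end RandomSubset

/-! ### The binomial random graph: FKG inequality and joint law of two degrees -/

section GraphExpectation

variable {n : ℕ}

instance : MeasurableSingletonClass (SimpleGraph (Fin n)) where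
  measurableSet_singleton G := by
    have : ({G} : Set (SimpleGraph (Fin n))) = SimpleGraph.edgeSet ⁻¹' {G.edgeSet} := by
      ext H; simp
    rw [this]
    exact SimpleGraph.measurable_edgeSet (measurableSet_singleton _)

/-- The probability of the graph `G` under `G(n, p)`. -/
noncomputable def graphWeight (p : I) (G : SimpleGraph (Fin n)) : ℝ := (graphMeasure p n).real {G}

lemma graphWeight_eq (p : I) (G : SimpleGraph (Fin n)) : graphWeight p G =
    (p : ℝ) ^ G.edgeSet.ncard * (1 - p : ℝ) ^ (n.choose 2 - G.edgeSet.ncard) := by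
  rw [graphWeight, measureReal_def, SimpleGraph.binomialRandom_singleton]
  simp

lemma graphWeight_nonneg (p : I) (G : SimpleGraph (Fin n)) : 0 ≤ graphWeight p G :=
  measureReal_nonneg

lemma integral_graphMeasure (p : I) (f : SimpleGraph (Fin n) → ℝ) :
    ∫ G, f G ∂(graphMeasure p n) = ∑ G, graphWeight p G * f G :=
  integral_fintype .of_finite

lemma sum_graphWeight (p : I) : ∑ G : SimpleGraph (Fin n), graphWeight p G = 1 := by
  have := integral_graphMeasure (n := n) p fun _ => 1
  simpa using this.symm

/-- The weight depends on the number of edges only, and this number is modular on the lattice of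
graphs. It supplies the lattice condition of `fkg`, with equality. -/
lemma graphWeight_mul (p : I) (G H : SimpleGraph (Fin n)) :
    graphWeight p G * graphWeight p H = graphWeight p (G ⊓ H) * graphWeight p (G ⊔ H) := by
  have h := Set.ncard_inter_add_ncard_union G.edgeSet H.edgeSet
  rw [← SimpleGraph.edgeSet_inf, ← SimpleGraph.edgeSet_sup] at h
  have hle : ∀ K : SimpleGraph (Fin n), K.edgeSet.ncard ≤ n.choose 2 := fun K => by
    classical
    rw [← SimpleGraph.coe_edgeFinset, Set.ncard_coe_finset]
    simpa using K.card_edgeFinset_le_card_choose_two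
  have key : ∀ a b c d N : ℕ, a ≤ N → b ≤ N → c ≤ N → d ≤ N → c + d = a + b →
      (p : ℝ) ^ a * (1 - p : ℝ) ^ (N - a) * ((p : ℝ) ^ b * (1 - p : ℝ) ^ (N - b)) =
        (p : ℝ) ^ c * (1 - p : ℝ) ^ (N - c) * ((p : ℝ) ^ d * (1 - p : ℝ) ^ (N - d)) := by
    intro a b c d N ha hb hc hd h
    rw [mul_mul_mul_comm, mul_mul_mul_comm ((p : ℝ) ^ c), ← pow_add, ← pow_add, ← pow_add,
      ← pow_add]
    congr 2 <;> omega
  simp only [graphWeight_eq]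
  exact key _ _ _ _ _ (hle G) (hle H) (hle _) (hle _) h

/-- Increasing functions of the binomial random graph are positively correlated. -/
lemma sum_graphWeight_mul_le (p : I) {f g : SimpleGraph (Fin n) → ℝ} (hf : Monotone f)
    (hg : Monotone g) : (∑ G, graphWeight p G * f G) * ∑ G, graphWeight p G * g G ≤
      ∑ G, graphWeight p G * (f G * g G) := by
  -- `fkg` wants nonnegative functions; subtracting the minimum, attained at the empty graph, leaves
  -- the covariance unchanged.
  have h := fkg (μ := graphWeight (n := n) p) (f := fun G => f G - f ⊥) (g := fun G => g G - g ⊥)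
    (fun G => graphWeight_nonneg p G) (fun G => sub_nonneg.2 (hf bot_le))
    (fun G => sub_nonneg.2 (hg bot_le)) (fun _ _ h => sub_le_sub_right (hf h) _)
    (fun _ _ h => sub_le_sub_right (hg h) _) fun G H => (graphWeight_mul p G H).le
  rw [sum_graphWeight, one_mul] at h
  have e : ∀ k : SimpleGraph (Fin n) → ℝ, ∑ G, graphWeight p G * (k G - k ⊥) =
      ∑ G, graphWeight p G * k G - k ⊥ := fun k => by
    simp only [mul_sub, Finset.sum_sub_distrib]
    rw [← Finset.sum_mul, sum_graphWeight, one_mul]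
  have e2 : ∑ G, graphWeight p G * ((f G - f ⊥) * (g G - g ⊥)) =
      ∑ G, graphWeight p G * (f G * g G) - (∑ G, graphWeight p G * f G) * g ⊥
        - f ⊥ * (∑ G, graphWeight p G * g G) + f ⊥ * g ⊥ * ∑ G, graphWeight (n := n) p G := by
    rw [Finset.sum_mul, Finset.mul_sum, Finset.mul_sum, ← Finset.sum_sub_distrib,
      ← Finset.sum_sub_distrib, ← Finset.sum_add_distrib]
    exact Finset.sum_congr rfl fun G _ => by ring
  rw [e, e, e2, sum_graphWeight] at h
  linarith

/-- A graph is its edge set, an arbitrary set of non-diagonal pairs; this transfers the product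
structure of random subsets to the random graph. -/
lemma sum_graphWeight_edgeFinset (p : I) [∀ G : SimpleGraph (Fin n), Fintype G.edgeSet]
    (f : Finset (Sym2 (Fin n)) → ℝ) :
    ∑ G : SimpleGraph (Fin n), graphWeight p G * f G.edgeFinset =
      subsetMean p (Finset.univ.filter fun e : Sym2 (Fin n) => ¬ e.IsDiag) f := by
  have hD : (Finset.univ.filter fun e : Sym2 (Fin n) => ¬ e.IsDiag).card = n.choose 2 := by
    have := Sym2.card_diagSet_compl (α := Fin n)
    rw [Fintype.card_fin] at this
    rw [← this, ← Set.toFinset_card]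
    congr 1
    ext e
    simp
  rw [subsetMean, hD]
  refine Finset.sum_bij (fun G _ => G.edgeFinset) ?_ ?_ ?_ ?_
  · intro G _
    simp only [Finset.mem_powerset]
    intro e he
    simpa using G.not_isDiag_of_mem_edgeFinset he
  · intro G _ H _ h
    exact SimpleGraph.edgeFinset_inj.1 h
  · intro s hs
    refine ⟨SimpleGraph.fromEdgeSet (s : Set (Sym2 (Fin n))), Finset.mem_univ _, ?_⟩
    ext e
    simp only [SimpleGraph.mem_edgeFinset, SimpleGraph.edgeSet_fromEdgeSet]
    constructor
    · rintro ⟨h, -⟩; exact h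
    · intro h
      refine ⟨h, ?_⟩
      simpa using Finset.mem_powerset.1 hs h
  · intro G _
    rw [graphWeight_eq, ← SimpleGraph.coe_edgeFinset, Set.ncard_coe_finset]

/-- The edges from `v` to the vertices other than `w`. -/
def edgesAvoiding (v w : Fin n) : Finset (Sym2 (Fin n)) :=
  ((Finset.univ.erase v).erase w).image fun x => s(v, x)

/-- The edges which contain neither `v` nor `w`. -/
def edgesAway (v w : Fin n) : Finset (Sym2 (Fin n)) :=
  Finset.univ.filter fun e => ¬ e.IsDiag ∧ v ∉ e ∧ w ∉ e

lemma mem_edgesAvoiding {v w : Fin n} (hvw : v ≠ w) {e : Sym2 (Fin n)}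
    (he : e ∈ edgesAvoiding v w) : v ∈ e ∧ w ∉ e := by
  obtain ⟨x, hx, rfl⟩ := Finset.mem_image.1 he
  simp only [Finset.mem_erase, Finset.mem_univ, and_true] at hx
  simp [hvw.symm, hx.1.symm]

lemma mem_edgesAway {v w : Fin n} {e : Sym2 (Fin n)} (he : e ∈ edgesAway v w) : v ∉ e ∧ w ∉ e :=
  (Finset.mem_filter.1 he).2.2

lemma card_edgesAvoiding {m : ℕ} {v w : Fin (m + 2)} (hvw : v ≠ w) :
    (edgesAvoiding v w).card = m := by
  rw [edgesAvoiding, Finset.card_image_of_injective _ fun x y h => Sym2.congr_right.1 h,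
    Finset.card_erase_of_mem (by simp [hvw.symm]), Finset.card_erase_of_mem (by simp)]
  simp

lemma disjoint_edgesAvoiding_edgesAway {v w : Fin n} (hvw : v ≠ w) :
    Disjoint (edgesAvoiding w v) (edgesAway v w) :=
  Finset.disjoint_left.2 fun _ h1 h2 => (mem_edgesAway h2).2 (mem_edgesAvoiding hvw.symm h1).1

lemma disjoint_edgesAvoiding_union {v w : Fin n} (hvw : v ≠ w) :
    Disjoint (edgesAvoiding v w) (edgesAvoiding w v ∪ edgesAway v w) :=
  Finset.disjoint_left.2 fun e h1 h2 => by
    rcases Finset.mem_union.1 h2 with h | h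
    · exact (mem_edgesAvoiding hvw.symm h).2 (mem_edgesAvoiding hvw h1).1
    · exact (mem_edgesAway h).1 (mem_edgesAvoiding hvw h1).1

lemma mk_notMem_union {v w : Fin n} (hvw : v ≠ w) :
    s(v, w) ∉ edgesAvoiding v w ∪ (edgesAvoiding w v ∪ edgesAway v w) := by
  simp only [Finset.mem_union, not_or]
  exact ⟨fun h => (mem_edgesAvoiding hvw h).2 (by simp),
    fun h => (mem_edgesAvoiding hvw.symm h).2 (by simp), fun h => (mem_edgesAway h).1 (by simp)⟩

/-- The four disjoint blocks decouple the two degrees: apart from the shared edge, each degree sees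
a block of its own, and the last block is seen by neither. -/
lemma edges_eq_insert {v w : Fin n} (hvw : v ≠ w) :
    (Finset.univ.filter fun e : Sym2 (Fin n) => ¬ e.IsDiag) =
      insert s(v, w) (edgesAvoiding v w ∪ (edgesAvoiding w v ∪ edgesAway v w)) := by
  ext e
  induction e using Sym2.ind with
  | _ x y =>
    simp only [edgesAvoiding, edgesAway, Finset.mem_filter, Finset.mem_univ, true_and,
      Finset.mem_insert, Finset.mem_union, Finset.mem_image, Finset.mem_erase, and_true,
      Sym2.mem_iff, Sym2.eq_iff, Sym2.mk_isDiag_iff]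
    constructor
    · intro h
      by_cases h1 : v = x
      · by_cases h2 : w = y
        · simp [h1, h2]
        · exact Or.inr (Or.inl ⟨y, ⟨fun h => h2 h.symm, fun h' => h (by rw [h', h1])⟩,
            Or.inl ⟨h1, rfl⟩⟩)
      · by_cases h2 : v = y
        · by_cases h3 : w = x
          · simp [h2, h3]
          · exact Or.inr (Or.inl ⟨x, ⟨fun h => h3 h.symm, fun h' => h1 h'.symm⟩,
              Or.inr ⟨h2, rfl⟩⟩)
        · by_cases h3 : w = x
          · exact Or.inr (Or.inr (Or.inl ⟨y, ⟨fun h' => h2 h'.symm,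
              fun h' => h (by rw [h', h3])⟩, Or.inl ⟨h3, rfl⟩⟩))
          · by_cases h4 : w = y
            · exact Or.inr (Or.inr (Or.inl ⟨x, ⟨fun h' => h1 h'.symm,
                fun h' => h3 h'.symm⟩, Or.inr ⟨h4, rfl⟩⟩))
            · exact Or.inr (Or.inr (Or.inr ⟨h, by tauto, by tauto⟩))
    · rintro ((⟨rfl, rfl⟩ | ⟨rfl, rfl⟩) | ⟨z, hz, (⟨rfl, rfl⟩ | ⟨rfl, rfl⟩)⟩ |
        ⟨z, hz, (⟨rfl, rfl⟩ | ⟨rfl, rfl⟩)⟩ | h)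
      · exact hvw
      · exact hvw.symm
      · exact hz.2.symm
      · exact hz.2
      · exact hz.2.symm
      · exact hz.2
      · exact h.1

lemma card_filter_mem_union {v w : Fin n} (hvw : v ≠ w) {a b c : Finset (Sym2 (Fin n))}
    (ha : a ⊆ edgesAvoiding v w) (hb : b ⊆ edgesAvoiding w v) (hc : c ⊆ edgesAway v w) :
    ((a ∪ (b ∪ c)).filter (v ∈ ·)).card = a.card ∧
      ((a ∪ (b ∪ c)).filter (w ∈ ·)).card = b.card := by
  constructor
  · congr 1
    rw [Finset.filter_union, Finset.filter_union,
      Finset.filter_true_of_mem fun e he => (mem_edgesAvoiding hvw (ha he)).1,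
      Finset.filter_false_of_mem fun e he => (mem_edgesAvoiding hvw.symm (hb he)).2,
      Finset.filter_false_of_mem fun e he => (mem_edgesAway (hc he)).1]
    simp
  · congr 1
    rw [Finset.filter_union, Finset.filter_union,
      Finset.filter_false_of_mem fun e he => (mem_edgesAvoiding hvw (ha he)).2,
      Finset.filter_true_of_mem fun e he => (mem_edgesAvoiding hvw.symm (hb he)).1,
      Finset.filter_false_of_mem fun e he => (mem_edgesAway (hc he)).2]
    simp

lemma subsetMean_mul_card (p : ℝ) {α : Type*} (A B R : Finset α) (F H : ℕ → ℝ) :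
    subsetMean p A (fun a => subsetMean p B fun b => subsetMean p R fun _ =>
      F a.card * H b.card) = binomialMean p A.card F * binomialMean p B.card H := by
  have e1 : ∀ x : ℝ, subsetMean (p : ℝ) R (fun _ => x) = x := fun x => by
    have := subsetMean_const_mul p R (fun _ => 1) x
    simpa only [subsetMean_one, mul_one] using this
  simp only [e1, subsetMean_const_mul, subsetMean_mul_const]
  rw [subsetMean_card p A F, subsetMean_card p B H]

open Classical in
/-- The joint law of the degrees of two vertices: given the edge between them, they are independent
and binomial. -/
lemma sum_graphWeight_degree_mul_degree (p : I) {m : ℕ} {v w : Fin (m + 2)} (hvw : v ≠ w)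
    (F H : ℕ → ℝ) : ∑ G, graphWeight p G * (F (G.degree v) * H (G.degree w)) =
      p * (binomialMean p m (fun k => F (k + 1)) * binomialMean p m fun k => H (k + 1)) +
        (1 - p) * (binomialMean p m F * binomialMean p m H) := by
  have h1 : ∑ G, graphWeight p G * (F (G.degree v) * H (G.degree w)) =
      ∑ G : SimpleGraph (Fin (m + 2)), graphWeight p G *
        (fun s : Finset (Sym2 (Fin (m + 2))) =>
          F (s.filter (v ∈ ·)).card * H (s.filter (w ∈ ·)).card) G.edgeFinset := by
    refine Finset.sum_congr rfl fun G _ => ?_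
    rw [← SimpleGraph.card_incidenceFinset_eq_degree,
      ← SimpleGraph.card_incidenceFinset_eq_degree, SimpleGraph.incidenceFinset_eq_filter,
      SimpleGraph.incidenceFinset_eq_filter]
  rw [h1, sum_graphWeight_edgeFinset (n := m + 2) p (fun s : Finset (Sym2 (Fin (m + 2))) =>
    F (s.filter (v ∈ ·)).card * H (s.filter (w ∈ ·)).card), edges_eq_insert hvw,
    subsetMean_insert _ (mk_notMem_union hvw),
    subsetMean_union _ (disjoint_edgesAvoiding_union hvw),
    subsetMean_union _ (disjoint_edgesAvoiding_union hvw)]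
  simp only [subsetMean_union _ (disjoint_edgesAvoiding_edgesAway hvw)]
  have key := fun F' H' => subsetMean_mul_card p (edgesAvoiding v w) (edgesAvoiding w v)
    (edgesAway v w) F' H'
  simp only [card_edgesAvoiding hvw, card_edgesAvoiding hvw.symm] at key
  rw [← key, ← key]
  refine congrArg₂ (· + ·) (congrArg ((p : ℝ) * ·) ?_)
    (congrArg ((1 - p : ℝ) * ·) ?_)
  · refine subsetMean_congr fun a ha => subsetMean_congr fun b hb => subsetMean_congr fun c hc => ?_
    obtain ⟨c1, c2⟩ := card_filter_mem_union hvw ha hb hc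
    have hn : s(v, w) ∉ a ∪ (b ∪ c) := fun h => mk_notMem_union hvw
      (Finset.union_subset_union ha (Finset.union_subset_union hb hc) h)
    rw [Finset.filter_insert, if_pos (by simp), Finset.filter_insert, if_pos (by simp),
      Finset.card_insert_of_notMem (fun h => hn (Finset.mem_filter.1 h).1),
      Finset.card_insert_of_notMem (fun h => hn (Finset.mem_filter.1 h).1), c1, c2]
  · refine subsetMean_congr fun a ha => subsetMean_congr fun b hb => subsetMean_congr fun c hc => ?_
    obtain ⟨c1, c2⟩ := card_filter_mem_union hvw ha hb hc
    rw [c1, c2]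

open Classical in
lemma sum_graphWeight_degree (p : I) {m : ℕ} (v : Fin (m + 2)) (F : ℕ → ℝ) :
    ∑ G, graphWeight p G * F (G.degree v) = binomialMean p (m + 1) F := by
  -- The marginal law comes from the joint law with any second vertex and the constant test function
  -- `1`; the shared edge then acts as the last binomial trial.
  obtain ⟨w, hw⟩ := exists_ne v
  have h := sum_graphWeight_degree_mul_degree p hw.symm F fun _ => 1
  simp only [mul_one, binomialMean_one] at h
  rw [h, binomialMean_succ]

end GraphExpectation

/-! ### Total variation distance on the natural numbers -/

section TotalVariation

lemma summable_mul_real_singleton (μ : Measure ℕ) [IsProbabilityMeasure μ] {a : ℕ → ℝ}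
    (ha0 : ∀ k, 0 ≤ a k) (ha1 : ∀ k, a k ≤ 1) : Summable fun k => a k * μ.real {k} := by
  have h : Summable fun k => μ.real {k} := by
    have := hasSum_integral_iUnion (μ := μ) (f := fun _ : ℕ => (1 : ℝ)) (s := fun k : ℕ => {k})
      (fun _ => MeasurableSet.of_discrete) (fun i j hij => by simpa using hij)
      (integrable_const _).integrableOn
    simpa [measureReal_def] using this.summable
  exact h.of_nonneg_of_le (fun k => mul_nonneg (ha0 k) measureReal_nonneg)
    fun k => mul_le_of_le_one_left measureReal_nonneg (ha1 k)

lemma tsum_mul_real_singleton (μ : Measure ℕ) [IsProbabilityMeasure μ] {a : ℕ → ℝ}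
    (ha0 : ∀ k, 0 ≤ a k) (ha1 : ∀ k, a k ≤ 1) : ∑' k, a k * μ.real {k} = ∫ k, a k ∂μ := by
  have hi : Integrable a μ := Integrable.of_bound (C := 1) .of_discrete
    (Eventually.of_forall fun k => by rw [Real.norm_of_nonneg (ha0 k)]; exact ha1 k)
  rw [integral_countable hi]
  exact tsum_congr fun k => by rw [smul_eq_mul, mul_comm]

lemma tsum_real_singleton (μ : Measure ℕ) [IsProbabilityMeasure μ] : ∑' k, μ.real {k} = 1 := by
  have := tsum_mul_real_singleton μ (a := fun _ => 1) (fun _ => zero_le_one) fun _ => le_rfl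
  simpa using this

/-- As both total masses are one, the positive and negative parts of the difference have equal mass,
so the indicator of the set where `μ` is heavier attains the distance. A one-sided bound over test
functions with values in `[0, 1]` therefore suffices. -/
lemma exists_tvDist_eq (μ ν : Measure ℕ) [IsProbabilityMeasure μ] [IsProbabilityMeasure ν] :
    ∃ a : ℕ → ℝ, (∀ k, 0 ≤ a k) ∧ (∀ k, a k ≤ 1) ∧
      tvDist μ ν = ∫ k, a k ∂μ - ∑' k, a k * ν.real {k} := by
  classical
  set a : ℕ → ℝ := fun k => if ν.real {k} < μ.real {k} then 1 else 0 with ha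
  have ha0 : ∀ k, 0 ≤ a k := fun k => by simp only [ha]; split_ifs <;> norm_num
  have ha1 : ∀ k, a k ≤ 1 := fun k => by simp only [ha]; split_ifs <;> norm_num
  refine ⟨a, ha0, ha1, ?_⟩
  have h : ∀ k, |μ.real {k} - ν.real {k}| = 2 * (a k * μ.real {k} - a k * ν.real {k}) -
      (1 * μ.real {k} - 1 * ν.real {k}) := fun k => by
    simp only [ha]
    split_ifs with h
    · rw [abs_of_pos (sub_pos.2 h)]; ring
    · rw [abs_of_nonpos (sub_nonpos.2 (not_lt.1 h))]; ring
  have s1 := summable_mul_real_singleton μ ha0 ha1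
  have s2 := summable_mul_real_singleton ν ha0 ha1
  have s3 := summable_mul_real_singleton μ (a := fun _ => 1) (fun _ => zero_le_one) fun _ => le_rfl
  have s4 := summable_mul_real_singleton ν (a := fun _ => 1) (fun _ => zero_le_one) fun _ => le_rfl
  rw [tvDist, ← tsum_mul_real_singleton μ ha0 ha1, tsum_congr h,
    ((s1.sub s2).mul_left 2).tsum_sub (s3.sub s4), s3.tsum_sub s4, tsum_mul_left, s1.tsum_sub s2]
  simp only [one_mul, tsum_real_singleton]
  ring

lemma abs_sub_le_tvDist (μ ν : Measure ℕ) [IsProbabilityMeasure μ] [IsProbabilityMeasure ν]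
    (k : ℕ) : |μ.real {k} - ν.real {k}| ≤ 2 * tvDist μ ν := by
  have s3 := summable_mul_real_singleton μ (a := fun _ => 1) (fun _ => zero_le_one) fun _ => le_rfl
  have s4 := summable_mul_real_singleton ν (a := fun _ => 1) (fun _ => zero_le_one) fun _ => le_rfl
  have s := (s3.sub s4).abs
  simp only [one_mul] at s
  have := s.le_tsum k fun _ _ => abs_nonneg _
  rw [tvDist]
  linarith

end TotalVariation

/-! ### The Stein-Chen bound for exceedances and the exact covariance -/

section GraphSteinChen

variable {n : ℕ}

lemma integral_countLaw (p : I) (t : ℝ) (a : ℕ → ℝ) :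
    ∫ k, a k ∂(countLaw p t n) = ∑ G, graphWeight p G * a (exceedanceCount p t n G) := by
  rw [countLaw, integral_map (Measurable.of_discrete).aemeasurable
    (Measurable.of_discrete).aestronglyMeasurable, integral_graphMeasure]

instance (p : I) (t : ℝ) : IsProbabilityMeasure (countLaw p t n) :=
  Measure.isProbabilityMeasure_map (Measurable.of_discrete).aemeasurable

open Classical in
/-- The indicator that the normalized degree of `v` exceeds the threshold, as a natural number. -/
noncomputable def exceedanceNat (p : I) (t : ℝ) (v : Fin n) (G : SimpleGraph (Fin n)) : ℕ :=
  if threshold t n < normalizedDegree p v G then 1 else 0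

lemma exceedanceNat_le_one (p : I) (t : ℝ) (v : Fin n) (G : SimpleGraph (Fin n)) :
    exceedanceNat p t v G ≤ 1 := by
  unfold exceedanceNat; split_ifs <;> simp

lemma cast_exceedanceNat (p : I) (t : ℝ) (v : Fin n) (G : SimpleGraph (Fin n)) :
    (exceedanceNat p t v G : ℝ) = exceedance p t v G := by
  unfold exceedanceNat exceedance; split_ifs <;> simp

lemma exceedanceCount_eq_sum (p : I) (t : ℝ) (G : SimpleGraph (Fin n)) :
    exceedanceCount p t n G = ∑ v, exceedanceNat p t v G :=
  Finset.card_filter _ _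

open Classical in
lemma normalizedDegree_mono (p : I) (v : Fin n) : Monotone (normalizedDegree p v) := by
  intro G H h
  unfold normalizedDegree
  have : G.degree v ≤ H.degree v := SimpleGraph.degree_le_of_le h
  gcongr

lemma exceedanceNat_mono (p : I) (t : ℝ) (v : Fin n) : Monotone (exceedanceNat p t v) := by
  intro G H h
  unfold exceedanceNat
  split_ifs with h1 h2
  · rfl
  · exact absurd (h1.trans_le (normalizedDegree_mono p v h)) h2
  · simp
  · rfl

lemma meanCount_eq_sum (p : I) (t : ℝ) : meanCount p t n =
    ∑ v : Fin n, ∑ G, graphWeight p G * exceedanceNat p t v G := by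
  rw [meanCount, integral_graphMeasure, Finset.sum_comm]
  refine Finset.sum_congr rfl fun G _ => ?_
  rw [exceedanceCount_eq_sum, Nat.cast_sum, Finset.mul_sum]

lemma meanCount_nonneg (p : I) (t : ℝ) : 0 ≤ meanCount p t n :=
  integral_nonneg fun _ => Nat.cast_nonneg _

/-- The Stein-Chen bound for the number of exceedances, as a sum over the vertices. -/
theorem poissonDistance_le_sum (p : I) (t : ℝ) (hmean : 0 < meanCount p t n) :
    poissonDistance p t n ≤ (1 - Real.exp (-meanCount p t n)) / meanCount p t n *
      ∑ v : Fin n, ((∑ G, graphWeight p G * exceedanceNat p t v G) ^ 2 +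
        ∑ u ∈ Finset.univ.erase v, (∑ G, graphWeight p G *
            (exceedanceNat p t v G * exceedanceNat p t u G) -
          (∑ G, graphWeight p G * exceedanceNat p t v G) *
            ∑ G, graphWeight p G * exceedanceNat p t u G)) := by
  set r := meanCount p t n with hr
  obtain ⟨a, ha0, ha1, ha⟩ := exists_tvDist_eq (countLaw p t n) (poissonMeasure r.toNNReal)
  rw [poissonDistance, ← hr, ha, integral_countLaw]
  set P : ℕ → ℝ := fun k => (poissonMeasure r.toNNReal).real {k} with hPdef
  have hP : ∀ k, P k = Real.exp (-r) * r ^ k / k ! := fun k => by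
    rw [hPdef]
    simp only [poissonMeasure_real_singleton, Real.coe_toNNReal r hmean.le]
  have hPsum : HasSum P 1 := by
    have := hasSum_one_poissonMeasure r.toNNReal
    rw [Real.coe_toNNReal r hmean.le] at this
    simpa only [← hP] using this
  have hP0 : P 0 = Real.exp (-r) := by simp [hP]
  have key := steinChen_of_association (w := graphWeight (n := n) p) (graphWeight_nonneg p)
    (sum_graphWeight p) (J := exceedanceNat p t) (exceedanceNat_le_one p t)
    (V := fun v G => ∑ u ∈ Finset.univ.erase v, exceedanceNat p t u G)
    (W := exceedanceCount p t n)
    (fun v G => by rw [exceedanceCount_eq_sum, Finset.sum_erase_add _ _ (Finset.mem_univ v)])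
    (exceedanceCount_eq_sum p t)
    -- Adding edges raises every degree, so the indicator at `v` and an increasing function of the
    -- count elsewhere are both increasing in the graph.
    (fun v h hh => sum_graphWeight_mul_le p
      (f := fun G => (exceedanceNat p t v G : ℝ))
      (g := fun G => h (∑ u ∈ Finset.univ.erase v, exceedanceNat p t u G))
      (fun G H hGH => Nat.cast_le.2 (exceedanceNat_mono p t v hGH))
      (fun G H hGH => hh (Finset.sum_le_sum fun u _ => exceedanceNat_mono p t u hGH)))
    hmean (meanCount_eq_sum p t) (P := P) (a := a) (fun k => by rw [hP]; positivity)
    (fun k => by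
      rw [hP, hP, Nat.factorial_succ]
      push_cast
      field_simp
      rw [pow_succ, mul_comm])
    hPsum ha0 ha1
  rw [hP0] at key
  refine key.trans (le_of_eq ?_)
  congr 1
  refine Finset.sum_congr rfl fun v _ => ?_
  congr 1
  rw [Finset.sum_sub_distrib, ← Finset.mul_sum]
  congr 1
  · rw [Finset.sum_comm]
    refine Finset.sum_congr rfl fun G _ => ?_
    push_cast
    rw [Finset.mul_sum, Finset.mul_sum]
  · congr 1
    rw [Finset.sum_comm]
    refine Finset.sum_congr rfl fun G _ => ?_
    push_cast
    rw [Finset.mul_sum]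

/-- With mean zero, graphs of positive weight have no exceedance, so both laws are the point mass at
`0`. This degenerate case is excluded from the Stein argument, which divides by the mean. -/
lemma poissonDistance_nonpos_of_meanCount_eq_zero (p : I) (t : ℝ) (hmean : meanCount p t n = 0) :
    poissonDistance p t n ≤ 0 := by
  obtain ⟨a, ha0, ha1, ha⟩ := exists_tvDist_eq (countLaw p t n) (poissonMeasure 0)
  rw [poissonDistance, hmean, Real.toNNReal_zero, ha, integral_countLaw]
  have h1 : ∀ G, graphWeight p G * a (exceedanceCount p t n G) = graphWeight p G * a 0 := by
    rw [meanCount, integral_graphMeasure, Finset.sum_eq_zero_iff_of_nonneg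
      fun G _ => mul_nonneg (graphWeight_nonneg p G) (Nat.cast_nonneg _)] at hmean
    intro G
    rcases mul_eq_zero.1 (hmean G (Finset.mem_univ G)) with h | h
    · simp [h]
    · rw [Nat.cast_eq_zero.1 h]
  have h2 : ∑' k, a k * (poissonMeasure 0).real {k} = a 0 := by
    rw [tsum_eq_single 0]
    · simp [poissonMeasure_real_singleton]
    · intro k hk
      simp [poissonMeasure_real_singleton, hk]
  rw [h2, Finset.sum_congr rfl fun G _ => h1 G, ← Finset.sum_mul, sum_graphWeight]
  simp

open Classical in
/-- The indicator that a vertex of degree `k` exceeds the threshold. -/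
noncomputable def degreeIndicator (p : I) (t : ℝ) (n k : ℕ) : ℝ :=
  if threshold t n < ((k : ℝ) - ((n : ℝ) - 1) * p) / √(((n : ℝ) - 1) * p * (1 - p)) then 1 else 0

open Classical in
lemma exceedance_eq_degreeIndicator (p : I) (t : ℝ) (v : Fin n) (G : SimpleGraph (Fin n)) :
    exceedance p t v G = degreeIndicator p t n (G.degree v) := rfl

variable {m : ℕ}

lemma sum_graphWeight_exceedance (p : I) (t : ℝ) (v : Fin (m + 2)) :
    ∑ G, graphWeight p G * exceedance p t v G =
      binomialMean p (m + 1) (degreeIndicator p t (m + 2)) := by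
  simp only [exceedance_eq_degreeIndicator]
  exact sum_graphWeight_degree p v _

lemma exceedanceProb_eq (p : I) (t : ℝ) (v : Fin (m + 2)) :
    exceedanceProb p t v = binomialMean p (m + 1) (degreeIndicator p t (m + 2)) := by
  rw [← sum_graphWeight_exceedance p t v, ← integral_graphMeasure, exceedanceProb,
    ← integral_indicator_one (Set.toFinite _).measurableSet]
  congr 1

lemma meanCount_eq (p : I) (t : ℝ) : meanCount p t (m + 2) =
    ((m + 2 : ℕ) : ℝ) * binomialMean p (m + 1) (degreeIndicator p t (m + 2)) := by
  simp only [meanCount_eq_sum, cast_exceedanceNat, sum_graphWeight_exceedance]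
  simp

lemma covariance_graphMeasure (p : I) (f g : SimpleGraph (Fin n) → ℝ) :
    cov[f, g; graphMeasure p n] = ∑ G, graphWeight p G * (f G * g G) -
      (∑ G, graphWeight p G * f G) * ∑ G, graphWeight p G * g G := by
  rw [covariance_eq_sub .of_discrete .of_discrete, integral_graphMeasure, integral_graphMeasure,
    integral_graphMeasure]
  rfl

/-- The covariance of two exceedance indicators: the two degrees are independent given the edge
between the two vertices. -/
lemma covariance_exceedance (p : I) (t : ℝ) {v w : Fin (m + 2)} (hvw : v ≠ w) :
    cov[exceedance p t v, exceedance p t w; graphMeasure p (m + 2)] =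
      p * (1 - p) * (binomialMean p m fun k => degreeIndicator p t (m + 2) (k + 1) -
        degreeIndicator p t (m + 2) k) ^ 2 := by
  have h : (binomialMean p m fun k => degreeIndicator p t (m + 2) (k + 1) -
      degreeIndicator p t (m + 2) k) = (binomialMean p m fun k => degreeIndicator p t (m + 2) (k + 1))
        - binomialMean p m (degreeIndicator p t (m + 2)) := by
    simp only [binomialMean, mul_sub, Finset.sum_sub_distrib]
  rw [covariance_graphMeasure, sum_graphWeight_exceedance, sum_graphWeight_exceedance]
  simp only [exceedance_eq_degreeIndicator]
  -- With `A` and `B` the exceedance probabilities given presence and absence of the edge, and `q =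
  -- 1 - p`, what remains is `p A² + q B² - (p A + q B)² = p q (A - B)²`.
  rw [sum_graphWeight_degree_mul_degree p hvw, binomialMean_succ, h]
  ring

/-- All vertices have the same exceedance probability and all pairs the same covariance, so the sum
over vertices collapses to the closed form. -/
theorem poissonDistance_le_steinChenBound (p : I) (t : ℝ) (n : ℕ) (hn : 2 ≤ n) :
    poissonDistance p t n ≤ steinChenBound p t n := by
  obtain ⟨m, rfl⟩ := Nat.exists_eq_add_of_le' hn
  rcases (meanCount_nonneg (n := m + 2) p t).eq_or_lt with h | h
  · refine (poissonDistance_nonpos_of_meanCount_eq_zero p t h.symm).trans (le_of_eq ?_)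
    simp [steinChenBound, ← h]
  · refine (poissonDistance_le_sum p t h).trans (le_of_eq ?_)
    set c := cov[exceedance p t (0 : Fin (m + 2)), exceedance p t (1 : Fin (m + 2));
      graphMeasure p (m + 2)] with hc
    set π := exceedanceProb p t (0 : Fin (m + 2)) with hπ
    have hc' : ∀ v, ∀ u ∈ Finset.univ.erase v, ∑ G, graphWeight p G *
            ((exceedanceNat p t v G : ℝ) * exceedanceNat p t u G) -
          (∑ G, graphWeight p G * (exceedanceNat p t v G : ℝ)) *
            ∑ G, graphWeight (n := m + 2) p G * (exceedanceNat p t u G : ℝ) = c := by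
      intro v u hu
      simp only [cast_exceedanceNat]
      rw [← covariance_graphMeasure, covariance_exceedance p t (Finset.ne_of_mem_erase hu).symm, hc,
        covariance_exceedance p t (by simp)]
    have hπ' : ∀ v : Fin (m + 2), ∑ G, graphWeight p G * (exceedanceNat p t v G : ℝ) = π := by
      intro v
      simp only [cast_exceedanceNat]
      rw [sum_graphWeight_exceedance, hπ, exceedanceProb_eq]
    have hr : meanCount p t (m + 2) = ((m + 2 : ℕ) : ℝ) * π := by
      rw [meanCount_eq, hπ, exceedanceProb_eq]
    have hsum : ∀ v : Fin (m + 2), (∑ G, graphWeight p G * (exceedanceNat p t v G : ℝ)) ^ 2 +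
        ∑ u ∈ Finset.univ.erase v, (∑ G, graphWeight p G *
            ((exceedanceNat p t v G : ℝ) * exceedanceNat p t u G) -
          (∑ G, graphWeight p G * (exceedanceNat p t v G : ℝ)) *
            ∑ G, graphWeight p G * (exceedanceNat p t u G : ℝ)) =
          π ^ 2 + (((m + 2 : ℕ) : ℝ) - 1) * c := by
      intro v
      rw [Finset.sum_congr rfl (hc' v), hπ', Finset.sum_const,
        Finset.card_erase_of_mem (Finset.mem_univ v)]
      rw [Finset.card_univ, Fintype.card_fin, nsmul_eq_mul]
      push_cast
      ring
    rw [Finset.sum_congr rfl fun v _ => hsum v, steinChenBound, ← hc, ← hπ]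
    simp only [Finset.sum_const, Finset.card_univ, Fintype.card_fin, nsmul_eq_mul]
    rw [hr] at h ⊢
    field_simp

end GraphSteinChen

/-! ### Local limit theorem for binomial weights in the moderate deviation range -/

section LocalLimit

/-- Second-order Taylor expansion of the entropy function. The cubic error is what later calls for
`y ^ 3 / √N → 0`. -/
lemma abs_one_add_mul_log_sub_le {u : ℝ} (hu : |u| ≤ 1 / 2) :
    |(1 + u) * Real.log (1 + u) - (u + u ^ 2 / 2)| ≤ 4 * |u| ^ 3 := by
  have h := Real.abs_log_sub_add_sum_range_le (x := -u) (by rw [abs_neg]; linarith) 2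
  simp only [Finset.sum_range_succ, Finset.sum_range_zero, abs_neg, sub_neg_eq_add] at h
  norm_num at h
  have h2 : |u| ^ 3 / (1 - |u|) ≤ 2 * |u| ^ 3 := by
    rw [div_le_iff₀ (by linarith)]
    nlinarith [pow_nonneg (abs_nonneg u) 3]
  set R := -u + u ^ 2 / 2 + Real.log (1 + u) with hR
  have e : (1 + u) * Real.log (1 + u) - (u + u ^ 2 / 2) = -(u ^ 3 / 2) + (1 + u) * R := by
    rw [hR]; ring
  have h3 : |1 + u| ≤ 3 / 2 := by
    have := abs_add_le 1 u
    rw [abs_one] at this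
    linarith
  rw [e]
  calc |-(u ^ 3 / 2) + (1 + u) * R| ≤ |-(u ^ 3 / 2)| + |(1 + u) * R| := abs_add_le _ _
    _ = |u| ^ 3 / 2 + |1 + u| * |R| := by
      rw [abs_neg, abs_div, abs_pow, abs_mul, abs_two]
    _ ≤ |u| ^ 3 / 2 + 3 / 2 * (2 * |u| ^ 3) := by
      gcongr
      exact h.trans h2
    _ ≤ 4 * |u| ^ 3 := by linarith [pow_nonneg (abs_nonneg u) 3]

lemma factorial_eq_stirlingSeq {n : ℕ} (hn : n ≠ 0) :
    (n ! : ℝ) = Stirling.stirlingSeq n * (√(2 * n) * (n / Real.exp 1) ^ n) := by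
  have : (0 : ℝ) < n := by positivity
  rw [Stirling.stirlingSeq, div_mul_cancel₀]
  positivity

/-- An exact form of Stirling's formula for a binomial weight. -/
lemma binomialWeight_eq {p : ℝ} (hp0 : 0 < p) (hp1 : p < 1) {N M : ℕ} {u v y : ℝ} (hu : -1 < u)
    (hv : v < 1) (hN : 0 < N) (hMle : M ≤ N) (hMu : (M : ℝ) = N * p * (1 + u))
    (hKv : (N : ℝ) - M = N * (1 - p) * (1 - v)) :
    binomialWeight p N M * √(2 * Real.pi) * √(N * p * (1 - p)) * Real.exp (y ^ 2 / 2) =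
      Stirling.stirlingSeq N * √Real.pi /
          (Stirling.stirlingSeq M * Stirling.stirlingSeq (N - M)) *
        (1 / √((1 + u) * (1 - v))) *
        Real.exp (y ^ 2 / 2 - (N * p * ((1 + u) * Real.log (1 + u)) +
          N * (1 - p) * ((1 - v) * Real.log (1 - v)))) := by
  obtain ⟨K, rfl⟩ := Nat.exists_eq_add_of_le hMle
  have hq : 0 < 1 - p := by linarith
  have hu' : 0 < 1 + u := by linarith
  have hv' : 0 < 1 - v := by linarith
  have hN' : (0 : ℝ) < ((M + K : ℕ) : ℝ) := by exact_mod_cast hN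
  have hK : (K : ℝ) = ((M + K : ℕ) : ℝ) * (1 - p) * (1 - v) := by rw [← hKv]; push_cast; ring
  have hMpos : (0 : ℝ) < M := by rw [hMu]; positivity
  have hKpos : (0 : ℝ) < K := by rw [hK]; positivity
  have hM0 : M ≠ 0 := by exact_mod_cast hMpos.ne'
  have hK0 : K ≠ 0 := by exact_mod_cast hKpos.ne'
  have hSM : 0 < Stirling.stirlingSeq M := by
    obtain ⟨j, rfl⟩ := Nat.exists_eq_succ_of_ne_zero hM0; exact Stirling.stirlingSeq'_pos j
  have hSK : 0 < Stirling.stirlingSeq K := by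
    obtain ⟨j, rfl⟩ := Nat.exists_eq_succ_of_ne_zero hK0; exact Stirling.stirlingSeq'_pos j
  rw [Nat.add_sub_cancel_left]
  have hchoose : ((M + K).choose M : ℝ) = (M + K)! / (M ! * K !) := by
    rw [Nat.choose_symm_add, Nat.add_choose, Nat.cast_div (Nat.factorial_mul_factorial_dvd_factorial_add M K)
      (by positivity)]
    push_cast; ring
  have hexp : Real.exp (y ^ 2 / 2 - (((M + K : ℕ) : ℝ) * p * ((1 + u) * Real.log (1 + u)) +
      ((M + K : ℕ) : ℝ) * (1 - p) * ((1 - v) * Real.log (1 - v)))) =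
      Real.exp (y ^ 2 / 2) / ((1 + u) ^ M * (1 - v) ^ K) := by
    rw [← mul_assoc, ← mul_assoc, ← hMu, ← hK, Real.exp_sub, Real.exp_add, mul_comm (M : ℝ),
      mul_comm (K : ℝ), ← Real.rpow_def_of_pos hu', ← Real.rpow_def_of_pos hv', Real.rpow_natCast,
      Real.rpow_natCast]
  have hroot : √(2 * ((M + K : ℕ) : ℝ)) * √(2 * Real.pi) * √(((M + K : ℕ) : ℝ) * p * (1 - p)) *
      √((1 + u) * (1 - v)) = √Real.pi * (√(2 * M) * √(2 * K)) := by
    rw [← Real.sqrt_mul (by positivity), ← Real.sqrt_mul (by positivity),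
      ← Real.sqrt_mul (by positivity), ← Real.sqrt_mul (by positivity),
      ← Real.sqrt_mul (by positivity)]
    congr 1
    have : (M : ℝ) * K = (((M + K : ℕ) : ℝ) * p * (1 + u)) *
      (((M + K : ℕ) : ℝ) * (1 - p) * (1 - v)) := by rw [← hMu, ← hK]
    linear_combination (-4 * Real.pi) * this
  have hpow : (((M + K : ℕ) : ℝ) / Real.exp 1) ^ (M + K) * p ^ M * (1 - p) ^ K *
      ((1 + u) ^ M * (1 - v) ^ K) = (M / Real.exp 1) ^ M * (K / Real.exp 1) ^ K := by
    rw [hMu, hK, pow_add]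
    simp only [div_pow, mul_pow]
    ring
  have hd : ((1 + u) ^ M * (1 - v) ^ K) ≠ 0 := by positivity
  have hr : √((1 + u) * (1 - v)) ≠ 0 := by positivity
  rw [hexp, binomialWeight, Nat.add_sub_cancel_left, hchoose, factorial_eq_stirlingSeq hN.ne',
    factorial_eq_stirlingSeq hM0, factorial_eq_stirlingSeq hK0]
  have hA : √(2 * (M : ℝ)) ≠ 0 := by positivity
  have hB : √(2 * (K : ℝ)) ≠ 0 := by positivity
  have hC : ((M : ℝ) / Real.exp 1) ^ M ≠ 0 := by positivity
  have hD : ((K : ℝ) / Real.exp 1) ^ K ≠ 0 := by positivity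
  -- From here on it is algebra in independent atoms: `hroot` matches the square-root factors of
  -- Stirling's formula and `hpow` the power factors.
  generalize Stirling.stirlingSeq (M + K) = SN at *
  generalize Stirling.stirlingSeq M = SM at *
  generalize Stirling.stirlingSeq K = SK at *
  generalize √(2 * (M : ℝ)) = A at *
  generalize √(2 * (K : ℝ)) = B at *
  generalize ((M : ℝ) / Real.exp 1) ^ M = C at *
  generalize ((K : ℝ) / Real.exp 1) ^ K = D at *
  generalize (((M + K : ℕ) : ℝ) / Real.exp 1) ^ (M + K) = E at *
  generalize √(2 * ((M + K : ℕ) : ℝ)) = F at *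
  generalize √(2 * Real.pi) = G at *
  generalize √(((M + K : ℕ) : ℝ) * p * (1 - p)) = H at *
  generalize √((1 + u) * (1 - v)) = Q at *
  generalize √Real.pi = Z at *
  generalize ((1 + u) ^ M * (1 - v) ^ K) = X at *
  generalize Real.exp (y ^ 2 / 2) = Y at *
  have hSM' := hSM.ne'
  have hSK' := hSK.ne'
  field_simp
  linear_combination (SN * E * p ^ M * (1 - p) ^ K * X * Y) * hroot + (SN * Z * A * B * Y) * hpow

variable {p : ℝ} {M : ℕ → ℕ} {y : ℕ → ℝ}

lemma tendsto_sqrt_natCast_atTop : Tendsto (fun N : ℕ => √(N : ℝ)) atTop atTop :=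
  Real.tendsto_sqrt_atTop.comp tendsto_natCast_atTop_atTop

lemma tendsto_div_sqrt (hy : Tendsto y atTop atTop)
    (hy3 : Tendsto (fun N => y N ^ 3 / √(N : ℝ)) atTop (𝓝 0)) :
    Tendsto (fun N => y N / √(N : ℝ)) atTop (𝓝 0) := by
  refine squeeze_zero' ?_ ?_ hy3
  · filter_upwards [hy.eventually_ge_atTop 1] with N hN
    positivity
  · filter_upwards [hy.eventually_ge_atTop 1] with N hN
    gcongr
    exact le_self_pow₀ hN (by norm_num)

lemma tendsto_natCast_div_self
    (hM : ∀ᶠ N : ℕ in atTop, (M N : ℝ) = N * p + y N * √(N * p * (1 - p)))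
    (hy : Tendsto (fun N => y N / √(N : ℝ)) atTop (𝓝 0)) :
    Tendsto (fun N : ℕ => (M N : ℝ) / N) atTop (𝓝 p) := by
  have h : Tendsto (fun N : ℕ => p + y N / √(N : ℝ) * √(p * (1 - p))) atTop (𝓝 p) := by
    simpa using (hy.mul_const (√(p * (1 - p)))).const_add p
  refine h.congr' ?_
  filter_upwards [hM, eventually_gt_atTop 0] with N hN hpos
  have h0 : (0 : ℝ) < N := by exact_mod_cast hpos
  rw [hN, mul_assoc, Real.sqrt_mul h0.le]
  have hs := Real.sq_sqrt h0.le
  have hs0 : √(N : ℝ) ≠ 0 := by positivity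
  field_simp
  linear_combination (-(y N * √(p * (1 - p)))) * hs

/-- The local limit theorem for the binomial distribution, with moderate deviations. -/
theorem tendsto_binomialWeight (hp0 : 0 < p) (hp1 : p < 1)
    (hM : ∀ᶠ N : ℕ in atTop, (M N : ℝ) = N * p + y N * √(N * p * (1 - p)))
    (hy : Tendsto (fun N => y N / √(N : ℝ)) atTop (𝓝 0))
    (hy3 : Tendsto (fun N => y N ^ 3 / √(N : ℝ)) atTop (𝓝 0)) :
    Tendsto (fun N : ℕ => binomialWeight p N (M N) * √(2 * Real.pi) * √(N * p * (1 - p)) *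
      Real.exp (y N ^ 2 / 2)) atTop (𝓝 1) := by
  have hq : 0 < 1 - p := by linarith
  set w := √(p * (1 - p)) with hw
  have hw0 : 0 < w := by positivity
  have hw2 : w ^ 2 = p * (1 - p) := Real.sq_sqrt (by positivity)
  -- `u` and `v` are the relative deviations of `M` and `N - M` from their means `N p` and `N (1 -
  -- p)`.
  set u : ℕ → ℝ := fun N => y N / √(N : ℝ) * (w / p) with hu
  set v : ℕ → ℝ := fun N => y N / √(N : ℝ) * (w / (1 - p)) with hv
  have hu0 : Tendsto u atTop (𝓝 0) := by simpa using hy.mul_const (w / p)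
  have hv0 : Tendsto v atTop (𝓝 0) := by simpa using hy.mul_const (w / (1 - p))
  have hMu : ∀ᶠ N : ℕ in atTop, (M N : ℝ) = N * p * (1 + u N) := by
    filter_upwards [hM, eventually_gt_atTop 0] with N hN hpos
    have h0 : (0 : ℝ) < N := by exact_mod_cast hpos
    have hs := Real.sq_sqrt h0.le
    have hs0 : √(N : ℝ) ≠ 0 := by positivity
    rw [hN, mul_assoc (N : ℝ) p (1 - p), Real.sqrt_mul h0.le, ← hw, hu]
    field_simp
    linear_combination (y N * w) * hs
  have hKv : ∀ᶠ N : ℕ in atTop, (N : ℝ) - M N = N * (1 - p) * (1 - v N) := by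
    filter_upwards [hM, eventually_gt_atTop 0] with N hN hpos
    have h0 : (0 : ℝ) < N := by exact_mod_cast hpos
    have hs := Real.sq_sqrt h0.le
    have hs0 : √(N : ℝ) ≠ 0 := by positivity
    rw [hN, mul_assoc (N : ℝ) p (1 - p), Real.sqrt_mul h0.le, ← hw, hv]
    field_simp
    linear_combination (-(y N * w)) * hs
  have hu1 : ∀ᶠ N in atTop, |u N| ≤ 1 / 2 := by
    have := hu0.abs
    rw [abs_zero] at this
    exact this.eventually_le_const (by norm_num)
  have hv1 : ∀ᶠ N in atTop, |v N| ≤ 1 / 2 := by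
    have := hv0.abs
    rw [abs_zero] at this
    exact this.eventually_le_const (by norm_num)
  have hMN := tendsto_natCast_div_self hM hy
  have hMtop : Tendsto M atTop atTop := by
    rw [← tendsto_natCast_atTop_iff (R := ℝ)]
    refine (hMN.pos_mul_atTop hp0 tendsto_natCast_atTop_atTop).congr' ?_
    filter_upwards [eventually_gt_atTop 0] with N hpos
    have h0 : (N : ℝ) ≠ 0 := by exact_mod_cast hpos.ne'
    field_simp
  have hle : ∀ᶠ N in atTop, M N ≤ N := by
    filter_upwards [hKv, hv1] with N h1 h2
    have h3 := (abs_le.1 h2).2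
    have : 0 ≤ (N : ℝ) - M N := by
      rw [h1]
      have : 0 ≤ 1 - v N := by linarith
      positivity
    exact_mod_cast sub_nonneg.1 this
  have hKtop : Tendsto (fun N => N - M N) atTop atTop := by
    rw [← tendsto_natCast_atTop_iff (R := ℝ)]
    have h1 : Tendsto (fun N : ℕ => 1 - (M N : ℝ) / N) atTop (𝓝 (1 - p)) := hMN.const_sub 1
    refine (h1.pos_mul_atTop hq tendsto_natCast_atTop_atTop).congr' ?_
    filter_upwards [eventually_gt_atTop 0, hle] with N hpos hle
    have h0 : (N : ℝ) ≠ 0 := by exact_mod_cast hpos.ne'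
    rw [Nat.cast_sub hle]
    field_simp
  have hS := Stirling.tendsto_stirlingSeq_sqrt_pi
  have hpi : √Real.pi ≠ 0 := by positivity
  have l1 : Tendsto (fun N => Stirling.stirlingSeq N * √Real.pi /
      (Stirling.stirlingSeq (M N) * Stirling.stirlingSeq (N - M N))) atTop (𝓝 1) := by
    have := (hS.mul_const (√Real.pi)).div ((hS.comp hMtop).mul (hS.comp hKtop))
      (mul_ne_zero hpi hpi)
    rwa [div_self (mul_ne_zero hpi hpi)] at this
  have l2 : Tendsto (fun N => 1 / √((1 + u N) * (1 - v N))) atTop (𝓝 1) := by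
    have h1 : Tendsto (fun N => (1 + u N) * (1 - v N)) atTop (𝓝 1) := by
      simpa using (hu0.const_add 1).mul (hv0.const_sub 1)
    have h2 := h1.sqrt
    rw [Real.sqrt_one] at h2
    simpa using h2.inv₀ one_ne_zero
  have l3 : Tendsto (fun N => Real.exp (y N ^ 2 / 2 -
      (N * p * ((1 + u N) * Real.log (1 + u N)) +
        N * (1 - p) * ((1 - v N) * Real.log (1 - v N))))) atTop (𝓝 1) := by
    have hE := Real.continuous_exp.tendsto 0
    rw [Real.exp_zero] at hE
    refine hE.comp ?_
    have hb : Tendsto (fun N => 4 * |y N ^ 3 / √(N : ℝ)| *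
        (p * (w / p) ^ 3 + (1 - p) * (w / (1 - p)) ^ 3)) atTop (𝓝 0) := by
      simpa using (hy3.abs.const_mul 4).mul_const
        (p * (w / p) ^ 3 + (1 - p) * (w / (1 - p)) ^ 3)
    refine squeeze_zero_norm' ?_ hb
    filter_upwards [hu1, hv1, eventually_gt_atTop 0] with N h1 h2 hpos
    have h0 : (0 : ℝ) < N := by exact_mod_cast hpos
    have hs := Real.sq_sqrt h0.le
    have hs0 : 0 < √(N : ℝ) := by positivity
    have b1 := abs_one_add_mul_log_sub_le h1
    have b2 := abs_one_add_mul_log_sub_le (u := -v N) (by rwa [abs_neg])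
    rw [abs_neg, ← sub_eq_add_neg] at b2
    -- The linear terms cancel since `p u = (1 - p) v`, and the quadratic ones add up to `y² / 2`
    -- since `1 / p + 1 / (1 - p) = 1 / w²`. Only the cubic errors are left.
    have e : y N ^ 2 / 2 - (N * p * ((1 + u N) * Real.log (1 + u N)) +
        N * (1 - p) * ((1 - v N) * Real.log (1 - v N))) =
        -(N * p * ((1 + u N) * Real.log (1 + u N) - (u N + u N ^ 2 / 2)) +
          N * (1 - p) * ((1 - v N) * Real.log (1 - v N) - (-v N + (-v N) ^ 2 / 2))) := by
      have : y N ^ 2 / 2 = N * p * (u N + u N ^ 2 / 2) +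
          N * (1 - p) * (-v N + (-v N) ^ 2 / 2) := by
        simp only [hu, hv]
        field_simp
        rw [hs]
        linear_combination (-(y N ^ 2 * N)) * hw2
      rw [this]
      ring
    have c1 : (N : ℝ) * p * |u N| ^ 3 = |y N ^ 3 / √(N : ℝ)| * (p * (w / p) ^ 3) := by
      simp only [hu, abs_mul, abs_div, abs_pow, abs_of_pos hs0, abs_of_pos hw0, abs_of_pos hp0]
      field_simp
      rw [hs, mul_comm]
    have c2 : (N : ℝ) * (1 - p) * |v N| ^ 3 =
        |y N ^ 3 / √(N : ℝ)| * ((1 - p) * (w / (1 - p)) ^ 3) := by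
      simp only [hv, abs_mul, abs_div, abs_pow, abs_of_pos hs0, abs_of_pos hw0, abs_of_pos hq]
      field_simp
      rw [hs, mul_comm]
    rw [e, norm_neg]
    refine (norm_add_le _ _).trans ?_
    rw [norm_mul (N * p : ℝ), norm_mul (N * (1 - p) : ℝ),
      Real.norm_of_nonneg (by positivity : 0 ≤ (N : ℝ) * p),
      Real.norm_of_nonneg (by positivity : 0 ≤ (N : ℝ) * (1 - p)), Real.norm_eq_abs,
      Real.norm_eq_abs]
    calc _ ≤ (N : ℝ) * p * (4 * |u N| ^ 3) + N * (1 - p) * (4 * |v N| ^ 3) := by gcongr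
      _ = 4 * (N * p * |u N| ^ 3) + 4 * (N * (1 - p) * |v N| ^ 3) := by ring
      _ = _ := by rw [c1, c2]; ring
  have := (l1.mul l2).mul l3
  rw [one_mul, one_mul] at this
  refine this.congr' ?_
  filter_upwards [hMu, hKv, hu1, hv1, hle, eventually_gt_atTop 0] with N h1 h2 h3 h4 h5 h6
  have := abs_le.1 h3
  have := abs_le.1 h4
  exact (binomialWeight_eq hp0 hp1 (by linarith) (by linarith) h6 h5 h1 h2).symm

end LocalLimit

/-! ### Comparison of sums with geometric series -/

section GeometricComparison

lemma sum_Ico_le_of_ratio_le {f : ℕ → ℝ} {ρ : ℝ} {m l : ℕ} (hf : ∀ k, 0 ≤ f k) (h0 : 0 ≤ ρ)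
    (h1 : ρ < 1) (h : ∀ k, m ≤ k → f (k + 1) ≤ ρ * f k) :
    ∑ k ∈ Finset.Ico m l, f k ≤ f m / (1 - ρ) := by
  have hpow : ∀ j, f (m + j) ≤ f m * ρ ^ j := fun j => by
    induction j with
    | zero => simp
    | succ j ih =>
      calc f (m + (j + 1)) ≤ ρ * f (m + j) := h (m + j) (Nat.le_add_right _ _)
        _ ≤ ρ * (f m * ρ ^ j) := by gcongr
        _ = f m * ρ ^ (j + 1) := by ring
  rw [Finset.sum_Ico_eq_sum_range]
  calc ∑ j ∈ Finset.range (l - m), f (m + j) ≤ ∑ j ∈ Finset.range (l - m), f m * ρ ^ j :=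
        Finset.sum_le_sum fun j _ => hpow j
    _ = f m * ∑ j ∈ Finset.range (l - m), ρ ^ j := by rw [Finset.mul_sum]
    _ ≤ f m * (1 - ρ)⁻¹ := by
        refine mul_le_mul_of_nonneg_left ?_ (hf m)
        rw [← tsum_geometric_of_lt_one h0 h1]
        exact (summable_geometric_of_lt_one h0 h1).sum_le_tsum _ fun _ _ => by positivity
    _ = f m / (1 - ρ) := by rw [div_eq_mul_inv]

/-- Only `j` terms are kept: with decreasing ratios, as in the binomial case, a constant lower bound
on the ratio is available on a limited stretch only. -/
lemma le_sum_Ico_of_le_ratio {f : ℕ → ℝ} {ρ : ℝ} {m j l : ℕ} (hf : ∀ k, 0 ≤ f k) (h0 : 0 ≤ ρ)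
    (h1 : ρ < 1) (h : ∀ k, m ≤ k → k < m + j → ρ * f k ≤ f (k + 1)) (hl : m + j ≤ l) :
    f m * (1 - ρ ^ j) / (1 - ρ) ≤ ∑ k ∈ Finset.Ico m l, f k := by
  have hpow : ∀ i < j, f m * ρ ^ i ≤ f (m + i) := fun i => by
    induction i with
    | zero => simp
    | succ i ih =>
      intro hi
      calc f m * ρ ^ (i + 1) = ρ * (f m * ρ ^ i) := by ring
        _ ≤ ρ * f (m + i) := by gcongr; exact ih (by omega)
        _ ≤ f (m + (i + 1)) := h (m + i) (Nat.le_add_right _ _) (by omega)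
  calc f m * (1 - ρ ^ j) / (1 - ρ) = ∑ i ∈ Finset.range j, f m * ρ ^ i := by
        rw [← Finset.mul_sum, geom_sum_eq h1.ne, ← neg_sub (ρ ^ j), ← neg_sub ρ]
        rw [mul_neg, neg_div_neg_eq, mul_div_assoc]
    _ ≤ ∑ i ∈ Finset.range j, f (m + i) :=
        Finset.sum_le_sum fun i hi => hpow i (Finset.mem_range.1 hi)
    _ = ∑ k ∈ Finset.Ico m (m + j), f k := by
        rw [Finset.sum_Ico_eq_sum_range, Nat.add_sub_cancel_left]
    _ ≤ ∑ k ∈ Finset.Ico m l, f k :=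
        Finset.sum_le_sum_of_subset_of_nonneg (Finset.Ico_subset_Ico_right hl) fun k _ _ => hf k

end GeometricComparison

/-! ### Binomial tail compared with its first term -/

section BinomialTail

variable {p : ℝ}

lemma binomialWeight_nonneg (hp0 : 0 < p) (hp1 : p < 1) (N k : ℕ) : 0 ≤ binomialWeight p N k := by
  have : 0 < 1 - p := by linarith
  unfold binomialWeight
  positivity

/-- The ratio of the binomial weights of `k + 1` and `k`. -/
noncomputable def binomialRatio (p : ℝ) (N k : ℕ) : ℝ :=
  ((N : ℝ) - k) * p / (((k : ℝ) + 1) * (1 - p))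

lemma binomialWeight_succ (hp1 : p < 1) {N k : ℕ} (hk : k ≤ N) :
    binomialWeight p N (k + 1) = binomialRatio p N k * binomialWeight p N k := by
  have hq : (1 - p) ≠ 0 := by linarith
  have hc : (N.choose (k + 1) : ℝ) * ((k : ℝ) + 1) = N.choose k * ((N : ℝ) - k) := by
    rw [← Nat.cast_sub hk]
    exact_mod_cast Nat.choose_succ_right_eq N k
  have hk1 : (k : ℝ) + 1 ≠ 0 := by positivity
  unfold binomialWeight binomialRatio
  rcases hk.eq_or_lt with rfl | hlt
  · simp
  · obtain ⟨j, rfl⟩ := Nat.exists_eq_add_of_lt hlt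
    have e1 : k + j + 1 - k = j + 1 := by omega
    have e2 : k + j + 1 - (k + 1) = j := by omega
    rw [e1, e2]
    field_simp
    linear_combination (p ^ (k + 1) * (1 - p) ^ (j + 1)) * hc

lemma binomialRatio_anti (hp0 : 0 < p) (hp1 : p < 1) {N k l : ℕ} (hkl : k ≤ l) (hl : l ≤ N) :
    binomialRatio p N l ≤ binomialRatio p N k := by
  have hq : 0 < 1 - p := by linarith
  have h1 : (k : ℝ) ≤ l := by exact_mod_cast hkl
  have h2 : (0 : ℝ) ≤ (N : ℝ) - l := by
    rw [sub_nonneg]; exact_mod_cast hl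
  unfold binomialRatio
  gcongr
  exact mul_nonneg (by linarith) hp0.le

lemma binomialRatio_nonneg (hp0 : 0 < p) (hp1 : p < 1) {N k : ℕ} (hk : k ≤ N) :
    0 ≤ binomialRatio p N k := by
  have hq : 0 < 1 - p := by linarith
  have h2 : (0 : ℝ) ≤ (N : ℝ) - k := by
    rw [sub_nonneg]; exact_mod_cast hk
  unfold binomialRatio
  positivity

lemma sum_Ico_binomialWeight_le (hp0 : 0 < p) (hp1 : p < 1) {N m : ℕ} (hm : m ≤ N)
    (hr : binomialRatio p N m < 1) :
    ∑ k ∈ Finset.Ico m (N + 1), binomialWeight p N k ≤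
      binomialWeight p N m / (1 - binomialRatio p N m) := by
  refine sum_Ico_le_of_ratio_le (binomialWeight_nonneg hp0 hp1 N)
    (binomialRatio_nonneg hp0 hp1 hm) hr fun k hk => ?_
  rcases le_or_gt k N with h | h
  · rw [binomialWeight_succ hp1 h]
    exact mul_le_mul_of_nonneg_right (binomialRatio_anti hp0 hp1 hk h)
      (binomialWeight_nonneg hp0 hp1 N k)
  · have : binomialWeight p N (k + 1) = 0 := by
      rw [binomialWeight, Nat.choose_eq_zero_of_lt (by omega)]; simp
    rw [this]
    exact mul_nonneg (binomialRatio_nonneg hp0 hp1 hm) (binomialWeight_nonneg hp0 hp1 N k)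

lemma le_sum_Ico_binomialWeight (hp0 : 0 < p) (hp1 : p < 1) {N m j : ℕ} (hm : m + j ≤ N)
    (hr : binomialRatio p N (m + j) < 1) :
    binomialWeight p N m * (1 - binomialRatio p N (m + j) ^ j) / (1 - binomialRatio p N (m + j)) ≤
      ∑ k ∈ Finset.Ico m (N + 1), binomialWeight p N k := by
  refine le_sum_Ico_of_le_ratio (binomialWeight_nonneg hp0 hp1 N)
    (binomialRatio_nonneg hp0 hp1 hm) hr (fun k hk hkj => ?_) (by omega)
  rw [binomialWeight_succ hp1 (by omega : k ≤ N)]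
  exact mul_le_mul_of_nonneg_right (binomialRatio_anti hp0 hp1 hkj.le hm)
    (binomialWeight_nonneg hp0 hp1 N k)

variable {M : ℕ → ℕ} {y : ℕ → ℝ}

/-- With `q = 1 - p` and `s² = N p q`, one minus the ratio at `k` is exactly `(k - N p + q) / ((k +
1) q)`. At `k = M + j` the numerator is `y s + j + q ~ y s` and the denominator is `~ s²`. An offset
`j` of order `√N` is harmless because `y → ∞`. -/
lemma tendsto_one_sub_binomialRatio (hp0 : 0 < p) (hp1 : p < 1)
    (hM : ∀ᶠ N : ℕ in atTop, (M N : ℝ) = N * p + y N * √(N * p * (1 - p)))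
    (hy : Tendsto y atTop atTop) (hy' : Tendsto (fun N => y N / √(N : ℝ)) atTop (𝓝 0))
    {j : ℕ → ℕ} {c : ℝ} (hj : ∀ N, (j N : ℝ) ≤ c * √(N : ℝ)) :
    Tendsto (fun N : ℕ => (1 - binomialRatio p N (M N + j N)) * √(N * p * (1 - p)) / y N)
      atTop (𝓝 1) := by
  have hq : 0 < 1 - p := by linarith
  have hMN := tendsto_natCast_div_self hM hy'
  have hsq := tendsto_sqrt_natCast_atTop
  have hinv : Tendsto (fun N : ℕ => 1 / (N : ℝ)) atTop (𝓝 0) := tendsto_one_div_atTop_nhds_zero_nat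
  have hjN : Tendsto (fun N : ℕ => (j N : ℝ) / N) atTop (𝓝 0) := by
    have h : Tendsto (fun N : ℕ => c * (√(N : ℝ))⁻¹) atTop (𝓝 0) := by
      simpa using hsq.inv_tendsto_atTop.const_mul c
    refine squeeze_zero' (Eventually.of_forall fun N => by positivity) ?_ h
    filter_upwards [eventually_gt_atTop 0] with N hpos
    have h0 : (0 : ℝ) < N := by exact_mod_cast hpos
    have hs := Real.sq_sqrt h0.le
    have hs0 : 0 < √(N : ℝ) := by positivity
    rw [div_le_iff₀ h0]
    refine (hj N).trans (le_of_eq ?_)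
    field_simp
    rw [hs]
  have hs_top : Tendsto (fun N : ℕ => √(N * p * (1 - p))) atTop atTop := by
    have : Tendsto (fun N : ℕ => √(N : ℝ) * √(p * (1 - p))) atTop atTop :=
      hsq.atTop_mul_const (by positivity)
    refine this.congr fun N => ?_
    rw [← Real.sqrt_mul (Nat.cast_nonneg N), mul_assoc]
  have l1 : Tendsto (fun N : ℕ => (1 - p) * ((√(N * p * (1 - p)))⁻¹ * (y N)⁻¹)) atTop (𝓝 0) := by
    simpa using (hs_top.inv_tendsto_atTop.mul hy.inv_tendsto_atTop).const_mul (1 - p)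
  have l2 : Tendsto (fun N : ℕ => (j N : ℝ) * ((√(N * p * (1 - p)))⁻¹ * (y N)⁻¹))
      atTop (𝓝 0) := by
    have h : Tendsto (fun N : ℕ => c * (√(p * (1 - p)))⁻¹ * (y N)⁻¹) atTop (𝓝 0) := by
      simpa using hy.inv_tendsto_atTop.const_mul (c * (√(p * (1 - p)))⁻¹)
    refine squeeze_zero' ?_ ?_ h
    · filter_upwards [hy.eventually_gt_atTop 0] with N hyN
      positivity
    · filter_upwards [hy.eventually_gt_atTop 0, eventually_gt_atTop 0] with N hyN hpos
      have h0 : (0 : ℝ) < N := by exact_mod_cast hpos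
      have hs0 : 0 < √(N : ℝ) := by positivity
      rw [mul_assoc (N : ℝ), Real.sqrt_mul h0.le, ← mul_assoc]
      refine mul_le_mul_of_nonneg_right ?_ (by positivity)
      rw [mul_inv, ← mul_assoc]
      refine mul_le_mul_of_nonneg_right ?_ (by positivity)
      rw [← div_eq_mul_inv, div_le_iff₀ hs0]
      exact hj N
  have l3 : Tendsto (fun N : ℕ => 1 + (j N : ℝ) * ((√(N * p * (1 - p)))⁻¹ * (y N)⁻¹) +
      (1 - p) * ((√(N * p * (1 - p)))⁻¹ * (y N)⁻¹)) atTop (𝓝 1) := by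
    simpa using (l2.const_add 1).add l1
  have l4 : Tendsto (fun N : ℕ => p / ((M N : ℝ) / N + j N / N + 1 / N)) atTop (𝓝 1) := by
    have h := (hMN.add hjN).add hinv
    rw [add_zero, add_zero] at h
    have := (tendsto_const_nhds (x := p)).div h hp0.ne'
    rwa [div_self hp0.ne'] at this
  have := l3.mul l4
  rw [one_mul] at this
  refine this.congr' ?_
  filter_upwards [hM, hy.eventually_gt_atTop 0, eventually_gt_atTop 0] with N hN hyN hpos
  have h0 : (0 : ℝ) < N := by exact_mod_cast hpos
  set s := √(N * p * (1 - p)) with hs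
  have hs0 : 0 < s := by positivity
  have hs2 : s ^ 2 = N * p * (1 - p) := Real.sq_sqrt (by positivity)
  have hden : (0 : ℝ) < M N + j N + 1 := by positivity
  have e1 : (1 + (j N : ℝ) * (s⁻¹ * (y N)⁻¹) + (1 - p) * (s⁻¹ * (y N)⁻¹)) =
      (y N * s + j N + (1 - p)) / (s * y N) := by
    field_simp
  have e2 : p / ((M N : ℝ) / N + j N / N + 1 / N) = N * p / (M N + j N + 1) := by
    field_simp
  have e3 : 1 - binomialRatio p N (M N + j N) =
      (y N * s + j N + (1 - p)) / ((M N + j N + 1) * (1 - p)) := by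
    rw [binomialRatio]
    push_cast
    field_simp
    rw [hN]
    ring
  rw [e1, e2, e3]
  have e4 : (N : ℝ) * p = s ^ 2 / (1 - p) := by rw [hs2]; field_simp
  rw [e4]
  field_simp

/-- The upper tail of the binomial distribution is comparable to its first term. -/
theorem tendsto_binomial_tail_div (hp0 : 0 < p) (hp1 : p < 1)
    (hM : ∀ᶠ N : ℕ in atTop, (M N : ℝ) = N * p + y N * √(N * p * (1 - p)))
    (hy : Tendsto y atTop atTop) (hy' : Tendsto (fun N => y N / √(N : ℝ)) atTop (𝓝 0))
    (hb : ∀ᶠ N in atTop, 0 < binomialWeight p N (M N)) :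
    Tendsto (fun N : ℕ => (∑ k ∈ Finset.Ico (M N) (N + 1), binomialWeight p N k) * y N /
      (√(N * p * (1 - p)) * binomialWeight p N (M N))) atTop (𝓝 1) := by
  have hq : 0 < 1 - p := by linarith
  have hMN := tendsto_natCast_div_self hM hy'
  have hsq := tendsto_sqrt_natCast_atTop
  -- Of order `√N`, the stretch is short enough to keep the ratio asymptotically unchanged, and long
  -- enough that its `j`-th power, about `exp (-y / √(p (1 - p)))`, vanishes.
  set j : ℕ → ℕ := fun N => ⌈√(N : ℝ)⌉₊ with hj
  have hj1 : ∀ N, (j N : ℝ) ≤ 2 * √(N : ℝ) := fun N => by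
    rcases Nat.eq_zero_or_pos N with rfl | hN
    · simp [hj]
    · have h1 : 1 ≤ √(N : ℝ) := by
        rw [Real.one_le_sqrt]; exact_mod_cast hN
      have := (Nat.ceil_lt_add_one (Real.sqrt_nonneg (N : ℝ))).le
      simp only [hj]
      linarith
  have r0 := tendsto_one_sub_binomialRatio hp0 hp1 hM hy hy' (j := fun _ => 0) (c := 0)
    (fun N => by simp)
  simp only [add_zero] at r0
  have r1 := tendsto_one_sub_binomialRatio hp0 hp1 hM hy hy' hj1
  have hle : ∀ᶠ N in atTop, M N + j N ≤ N := by
    have h1 : ∀ᶠ N : ℕ in atTop, (M N : ℝ) / N < (1 + p) / 2 :=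
      hMN.eventually_lt_const (by linarith)
    have h2 : ∀ᶠ N : ℕ in atTop, 4 / (1 - p) ≤ √(N : ℝ) := hsq.eventually_ge_atTop _
    filter_upwards [h1, h2, eventually_gt_atTop 0] with N h1 h2 hpos
    have h0 : (0 : ℝ) < N := by exact_mod_cast hpos
    have hs := Real.sq_sqrt h0.le
    have hs0 : 0 < √(N : ℝ) := by positivity
    rw [div_lt_iff₀ h0] at h1
    rw [div_le_iff₀ hq] at h2
    have h3 := hj1 N
    have : (M N : ℝ) + j N ≤ N := by nlinarith
    exact_mod_cast this
  -- the geometric ratio power tends to zero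
  have hpow : Tendsto (fun N => binomialRatio p N (M N + j N) ^ j N) atTop (𝓝 0) := by
    have hexp : Tendsto (fun N : ℕ => Real.exp (-((1 - binomialRatio p N (M N + j N)) *
        √(N * p * (1 - p)) / y N * (y N * (√(p * (1 - p)))⁻¹)))) atTop (𝓝 0) := by
      refine Real.tendsto_exp_neg_atTop_nhds_zero.comp ?_
      exact r1.pos_mul_atTop one_pos (hy.atTop_mul_const (by positivity))
    refine squeeze_zero' ?_ ?_ hexp
    · filter_upwards [hle] with N hN
      exact pow_nonneg (binomialRatio_nonneg hp0 hp1 hN) _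
    · filter_upwards [hle, hy.eventually_gt_atTop 0, eventually_gt_atTop 0,
        r1.eventually_const_lt zero_lt_one] with N hN hyN hpos hr
      have h0 : (0 : ℝ) < N := by exact_mod_cast hpos
      set ε := 1 - binomialRatio p N (M N + j N) with hε
      have hs0 : 0 < √(N * p * (1 - p)) := by positivity
      have hε0 : 0 < ε := by
        by_contra hcon
        have : ε * √(N * p * (1 - p)) / y N ≤ 0 :=
          div_nonpos_of_nonpos_of_nonneg
            (mul_nonpos_of_nonpos_of_nonneg (not_lt.1 hcon) hs0.le) hyN.le
        linarith
      have e : binomialRatio p N (M N + j N) = 1 - ε := by rw [hε]; ring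
      have hnn := binomialRatio_nonneg hp0 hp1 hN
      rw [e] at hnn ⊢
      have h1 : (1 - ε) ^ j N ≤ Real.exp (-ε) ^ j N :=
        pow_le_pow_left₀ hnn (by linarith [Real.add_one_le_exp (-ε)]) _
      refine h1.trans ?_
      rw [← Real.exp_nat_mul]
      refine Real.exp_le_exp.2 ?_
      have hw : 0 < √(p * (1 - p)) := by positivity
      have e2 : ε * √(N * p * (1 - p)) / y N * (y N * (√(p * (1 - p)))⁻¹) = ε * √(N : ℝ) := by
        rw [mul_assoc (N : ℝ), Real.sqrt_mul h0.le]
        field_simp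
      rw [e2]
      have : √(N : ℝ) ≤ j N := Nat.le_ceil _
      nlinarith
  have up : Tendsto (fun N : ℕ => ((1 - binomialRatio p N (M N)) * √(N * p * (1 - p)) / y N)⁻¹)
      atTop (𝓝 1) := by simpa using r0.inv₀ one_ne_zero
  have low : Tendsto (fun N : ℕ => (1 - binomialRatio p N (M N + j N) ^ j N) *
      ((1 - binomialRatio p N (M N + j N)) * √(N * p * (1 - p)) / y N)⁻¹) atTop (𝓝 1) := by
    simpa using (hpow.const_sub 1).mul (r1.inv₀ one_ne_zero)
  have pos_of : ∀ {ε s z : ℝ}, 0 < s → 0 < z → 0 < ε * s / z → 0 < ε := by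
    intro ε s z hs hz h
    by_contra hcon
    have : ε * s / z ≤ 0 := div_nonpos_of_nonpos_of_nonneg
      (mul_nonpos_of_nonpos_of_nonneg (not_lt.1 hcon) hs.le) hz.le
    linarith
  refine tendsto_of_tendsto_of_tendsto_of_le_of_le' low up ?_ ?_
  · filter_upwards [hle, hy.eventually_gt_atTop 0, eventually_gt_atTop 0,
      r1.eventually_const_lt zero_lt_one, hb] with N hN hyN hpos hr hbN
    have h0 : (0 : ℝ) < N := by exact_mod_cast hpos
    have hs0 : 0 < √(N * p * (1 - p)) := by positivity
    have hε := pos_of hs0 hyN hr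
    have := le_sum_Ico_binomialWeight hp0 hp1 hN (by linarith)
    rw [le_div_iff₀ (by positivity)]
    refine le_trans (le_of_eq ?_) (mul_le_mul_of_nonneg_right this hyN.le)
    field_simp
  · filter_upwards [hle, hy.eventually_gt_atTop 0, eventually_gt_atTop 0,
      r0.eventually_const_lt zero_lt_one, hb] with N hN hyN hpos hr hbN
    have h0 : (0 : ℝ) < N := by exact_mod_cast hpos
    have hs0 : 0 < √(N * p * (1 - p)) := by positivity
    have hε := pos_of hs0 hyN hr
    have := sum_Ico_binomialWeight_le hp0 hp1 ((Nat.le_add_right _ _).trans hN) (by linarith)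
    rw [div_le_iff₀ (by positivity)]
    refine (mul_le_mul_of_nonneg_right this hyN.le).trans (le_of_eq ?_)
    field_simp

end BinomialTail

/-! ### Asymptotics of the threshold -/

section Threshold

lemma tendsto_log_natCast_atTop : Tendsto (fun n : ℕ => Real.log n) atTop atTop :=
  Real.tendsto_log_atTop.comp tendsto_natCast_atTop_atTop

/-- `t - (log log n + log 4π) / 2`, the correction to `2 log n` in the threshold. -/
noncomputable def thresholdShift (t : ℝ) (n : ℕ) : ℝ :=
  t - (Real.log (Real.log n) + Real.log (4 * Real.pi)) / 2

/-- In the form `r + c / r` with `r² = 2 log n`, the half square is `log n + c + (c / r)² / 2`,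
whose last term tends to zero. -/
lemma threshold_eq (t : ℝ) {n : ℕ} (hn : 0 < Real.log n) :
    threshold t n = √(2 * Real.log n) + thresholdShift t n / √(2 * Real.log n) := by
  have h : (2 * Real.log n) ^ (-(1 / 2) : ℝ) = (√(2 * Real.log n))⁻¹ := by
    rw [Real.rpow_neg (by positivity), Real.sqrt_eq_rpow]
  rw [threshold, scaleA, shiftB, h, ← Real.sqrt_eq_rpow, thresholdShift]
  ring

lemma tendsto_thresholdShift_div_sqrt_log (t : ℝ) :
    Tendsto (fun n : ℕ => thresholdShift t n / √(2 * Real.log n)) atTop (𝓝 0) := by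
  have h1 : Tendsto (fun z : ℝ => Real.log z / √z) atTop (𝓝 0) := by
    have := (isLittleO_log_rpow_atTop (r := 1 / 2) (by norm_num)).tendsto_div_nhds_zero
    simpa only [← Real.sqrt_eq_rpow] using this
  have h2 : Tendsto (fun z : ℝ => (√z)⁻¹) atTop (𝓝 0) :=
    Real.tendsto_sqrt_atTop.inv_tendsto_atTop
  have h3 : Tendsto (fun z : ℝ => (t - Real.log (4 * Real.pi) / 2) * (√2)⁻¹ * (√z)⁻¹ -
      (2 * √2)⁻¹ * (Real.log z / √z)) atTop (𝓝 0) := by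
    simpa using (h2.const_mul ((t - Real.log (4 * Real.pi) / 2) * (√2)⁻¹)).sub
      (h1.const_mul (2 * √2)⁻¹)
  refine (h3.comp tendsto_log_natCast_atTop).congr' ?_
  filter_upwards [tendsto_log_natCast_atTop.eventually_gt_atTop 0] with n hn
  simp only [Function.comp_apply, thresholdShift]
  rw [Real.sqrt_mul (by norm_num)]
  field_simp
  ring

lemma tendsto_threshold_div_sqrt_log (t : ℝ) :
    Tendsto (fun n : ℕ => threshold t n / √(2 * Real.log n)) atTop (𝓝 1) := by
  have hr : Tendsto (fun n : ℕ => √(2 * Real.log n)) atTop atTop :=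
    Real.tendsto_sqrt_atTop.comp (tendsto_log_natCast_atTop.const_mul_atTop two_pos)
  have h : Tendsto (fun n : ℕ => 1 + thresholdShift t n / √(2 * Real.log n) *
      (√(2 * Real.log n))⁻¹) atTop (𝓝 1) := by
    simpa using ((tendsto_thresholdShift_div_sqrt_log t).mul hr.inv_tendsto_atTop).const_add 1
  refine h.congr' ?_
  filter_upwards [tendsto_log_natCast_atTop.eventually_gt_atTop 0] with n hn
  have : √(2 * Real.log n) ≠ 0 := by positivity
  rw [threshold_eq t hn]
  field_simp

lemma tendsto_threshold_atTop (t : ℝ) : Tendsto (threshold t) atTop atTop := by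
  have hr : Tendsto (fun n : ℕ => √(2 * Real.log n)) atTop atTop :=
    Real.tendsto_sqrt_atTop.comp (tendsto_log_natCast_atTop.const_mul_atTop two_pos)
  refine ((tendsto_threshold_div_sqrt_log t).pos_mul_atTop one_pos hr).congr' ?_
  filter_upwards [tendsto_log_natCast_atTop.eventually_gt_atTop 0] with n hn
  have : √(2 * Real.log n) ≠ 0 := by positivity
  field_simp

lemma tendsto_threshold_pow_three_div_sqrt (t : ℝ) :
    Tendsto (fun n : ℕ => threshold t n ^ 3 / √(n : ℝ)) atTop (𝓝 0) := by
  have h1 : Tendsto (fun n : ℕ => Real.log n ^ 3 / (n : ℝ)) atTop (𝓝 0) :=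
    (Real.isLittleO_pow_log_id_atTop (n := 3)).tendsto_div_nhds_zero.comp
      tendsto_natCast_atTop_atTop
  have h2 : Tendsto (fun n : ℕ => √(2 ^ 3 * (Real.log n ^ 3 / (n : ℝ)))) atTop (𝓝 0) := by
    have := (h1.const_mul (2 ^ 3)).sqrt
    rwa [mul_zero, Real.sqrt_zero] at this
  have h3 := ((tendsto_threshold_div_sqrt_log t).pow 3).mul h2
  rw [mul_zero] at h3
  refine h3.congr' ?_
  filter_upwards [tendsto_log_natCast_atTop.eventually_gt_atTop 0] with n hn
  have hr : 0 < √(2 * Real.log n) := by positivity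
  have e : √(2 ^ 3 * (Real.log n ^ 3 / (n : ℝ))) = √(2 * Real.log n) ^ 3 / √(n : ℝ) := by
    rw [← mul_div_assoc, ← mul_pow, Real.sqrt_div (by positivity)]
    congr 1
    rw [Real.sqrt_eq_iff_mul_self_eq (by positivity) (by positivity)]
    have := Real.sq_sqrt (by positivity : 0 ≤ 2 * Real.log n)
    calc (2 * Real.log n) ^ 3 = (√(2 * Real.log n) ^ 2) ^ 3 := by rw [this]
      _ = _ := by ring
  rw [e]
  field_simp

/-- The standard Gaussian tail at the threshold is asymptotic to `exp (-t) / n`. -/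
theorem tendsto_natCast_mul_exp_threshold (t : ℝ) :
    Tendsto (fun n : ℕ => n * Real.exp (-(threshold t n ^ 2 / 2)) /
      (√(2 * Real.pi) * threshold t n)) atTop (𝓝 (Real.exp (-t))) := by
  have h1 : Tendsto (fun n : ℕ => Real.exp (-t) * (threshold t n / √(2 * Real.log n))⁻¹ *
      Real.exp (-((thresholdShift t n / √(2 * Real.log n)) ^ 2 / 2))) atTop
      (𝓝 (Real.exp (-t))) := by
    have e := (Real.continuous_exp.tendsto 0)
    rw [Real.exp_zero] at e
    have h : Tendsto (fun n : ℕ => -((thresholdShift t n / √(2 * Real.log n)) ^ 2 / 2)) atTop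
        (𝓝 0) := by
      simpa using (((tendsto_thresholdShift_div_sqrt_log t).pow 2).div_const 2).neg
    simpa using (((tendsto_threshold_div_sqrt_log t).inv₀ one_ne_zero).const_mul
      (Real.exp (-t))).mul (e.comp h)
  refine h1.congr' ?_
  filter_upwards [tendsto_log_natCast_atTop.eventually_gt_atTop 0,
    (tendsto_threshold_atTop t).eventually_gt_atTop 0, eventually_gt_atTop 0] with n hn hx hpos
  have h0 : (0 : ℝ) < n := by exact_mod_cast hpos
  set r := √(2 * Real.log n) with hr
  have hr0 : 0 < r := by positivity
  have hr2 : r ^ 2 = 2 * Real.log n := Real.sq_sqrt (by positivity)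
  have hx2 : -(threshold t n ^ 2 / 2) = -Real.log n + -t +
      (Real.log (Real.log n) + Real.log (4 * Real.pi)) / 2 +
      -((thresholdShift t n / r) ^ 2 / 2) := by
    rw [threshold_eq t hn, ← hr]
    have : -Real.log n = -(r ^ 2 / 2) := by rw [hr2]; ring
    rw [this]
    have h2 : (Real.log (Real.log n) + Real.log (4 * Real.pi)) / 2 = t - thresholdShift t n := by
      rw [thresholdShift]; ring
    rw [h2]
    field_simp
    ring
  -- This is the purpose of the correction in `b_n`: it equals `√(4π log n)` and cancels the
  -- denominator of the Gaussian tail.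
  have hc : Real.exp ((Real.log (Real.log n) + Real.log (4 * Real.pi)) / 2) =
      √(2 * Real.pi) * r := by
    rw [← Real.log_mul hn.ne' (by positivity), hr, ← Real.sqrt_mul (by positivity),
      Real.sqrt_eq_rpow, Real.rpow_def_of_pos (by positivity)]
    congr 1
    rw [div_eq_mul_one_div]
    congr 2
    ring
  rw [hx2, Real.exp_add, Real.exp_add, Real.exp_add, Real.exp_neg (Real.log n),
    Real.exp_log h0, hc]
  field_simp

end Threshold

/-! ### Binomial weight and tail at the integer cutoff -/

section DegreeTail

variable {p : ℝ} {t : ℝ}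

/-- The least integer above `N p + x √(N p (1 - p))` for the threshold `x` of graphs on `N + 1`
vertices: the degrees from here on exceed the threshold. -/
noncomputable def degreeCutoff (p t : ℝ) (N : ℕ) : ℕ :=
  ⌊(N : ℝ) * p + threshold t (N + 1) * √(N * p * (1 - p))⌋₊ + 1

/-- The normalization of `degreeCutoff`. -/
noncomputable def normalizedCutoff (p t : ℝ) (N : ℕ) : ℝ :=
  (degreeCutoff p t N - N * p) / √(N * p * (1 - p))

lemma tendsto_sqrt_variance_atTop (hp0 : 0 < p) (hp1 : p < 1) :
    Tendsto (fun N : ℕ => √(N * p * (1 - p))) atTop atTop := by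
  have hq : 0 < 1 - p := by linarith
  have : Tendsto (fun N : ℕ => √(N : ℝ) * √(p * (1 - p))) atTop atTop :=
    tendsto_sqrt_natCast_atTop.atTop_mul_const (by positivity)
  refine this.congr fun N => ?_
  rw [← Real.sqrt_mul (Nat.cast_nonneg N), mul_assoc]

lemma sqrt_variance_pos (hp0 : 0 < p) (hp1 : p < 1) {N : ℕ} (hN : 0 < N) :
    0 < √(N * p * (1 - p)) := by
  have hq : 0 < 1 - p := by linarith
  have : (0 : ℝ) < N := by exact_mod_cast hN
  positivity

lemma degreeCutoff_eq (hp0 : 0 < p) (hp1 : p < 1) {N : ℕ} (hN : 0 < N) :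
    (degreeCutoff p t N : ℝ) = N * p + normalizedCutoff p t N * √(N * p * (1 - p)) := by
  have := (sqrt_variance_pos hp0 hp1 hN).ne'
  rw [normalizedCutoff]
  field_simp
  ring

lemma tendsto_threshold_succ_atTop (t : ℝ) :
    Tendsto (fun N : ℕ => threshold t (N + 1)) atTop atTop :=
  (tendsto_threshold_atTop t).comp (tendsto_add_atTop_nat 1)

lemma tendsto_sqrt_succ_div_sqrt :
    Tendsto (fun N : ℕ => √((N + 1 : ℕ) : ℝ) / √(N : ℝ)) atTop (𝓝 1) := by
  have h : Tendsto (fun N : ℕ => √(1 + 1 / (N : ℝ))) atTop (𝓝 1) := by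
    have := (tendsto_one_div_atTop_nhds_zero_nat (𝕜 := ℝ)).const_add 1
    rw [add_zero] at this
    simpa using this.sqrt
  refine h.congr' ?_
  filter_upwards [eventually_gt_atTop 0] with N hN
  have h0 : (0 : ℝ) < N := by exact_mod_cast hN
  rw [← Real.sqrt_div (by positivity)]
  congr 1
  push_cast
  field_simp

lemma tendsto_threshold_succ_pow_three_div_sqrt (t : ℝ) :
    Tendsto (fun N : ℕ => threshold t (N + 1) ^ 3 / √(N : ℝ)) atTop (𝓝 0) := by
  have h1 : Tendsto (fun N : ℕ => threshold t (N + 1) ^ 3 / √((N + 1 : ℕ) : ℝ)) atTop (𝓝 0) :=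
    (tendsto_threshold_pow_three_div_sqrt t).comp (tendsto_add_atTop_nat 1)
  have h := h1.mul tendsto_sqrt_succ_div_sqrt
  rw [zero_mul] at h
  refine h.congr fun N => ?_
  have : √((N + 1 : ℕ) : ℝ) ≠ 0 := by positivity
  field_simp

/-- Rounding up to an integer degree moves the threshold by at most one lattice step of the
normalized degree. -/
lemma normalizedCutoff_bounds (hp0 : 0 < p) (hp1 : p < 1) :
    ∀ᶠ N : ℕ in atTop, threshold t (N + 1) ≤ normalizedCutoff p t N ∧
      normalizedCutoff p t N ≤ threshold t (N + 1) + (√(N * p * (1 - p)))⁻¹ := by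
  filter_upwards [eventually_gt_atTop 0, (tendsto_threshold_succ_atTop t).eventually_gt_atTop 0]
    with N hN hx
  have hs := sqrt_variance_pos hp0 hp1 hN
  have h1 := Nat.lt_floor_add_one ((N : ℝ) * p + threshold t (N + 1) * √(N * p * (1 - p)))
  have h2 := Nat.floor_le (by positivity :
    0 ≤ (N : ℝ) * p + threshold t (N + 1) * √(N * p * (1 - p)))
  rw [normalizedCutoff, degreeCutoff]
  push_cast
  constructor
  · rw [le_div_iff₀ hs]; linarith
  · rw [div_le_iff₀ hs, add_mul, inv_mul_cancel₀ hs.ne']; linarith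

lemma tendsto_normalizedCutoff_atTop (hp0 : 0 < p) (hp1 : p < 1) :
    Tendsto (normalizedCutoff p t) atTop atTop :=
  tendsto_atTop_mono' _ ((normalizedCutoff_bounds hp0 hp1).mono fun _ h => h.1)
    (tendsto_threshold_succ_atTop t)

lemma tendsto_normalizedCutoff_div (hp0 : 0 < p) (hp1 : p < 1) :
    Tendsto (fun N : ℕ => normalizedCutoff p t N / threshold t (N + 1)) atTop (𝓝 1) := by
  have h : Tendsto (fun N : ℕ => 1 + (√(N * p * (1 - p)))⁻¹ * (threshold t (N + 1))⁻¹) atTop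
      (𝓝 1) := by
    simpa using ((tendsto_sqrt_variance_atTop hp0 hp1).inv_tendsto_atTop.mul
      (tendsto_threshold_succ_atTop t).inv_tendsto_atTop).const_add 1
  refine tendsto_of_tendsto_of_tendsto_of_le_of_le' tendsto_const_nhds h ?_ ?_
  · filter_upwards [normalizedCutoff_bounds (t := t) hp0 hp1,
      (tendsto_threshold_succ_atTop t).eventually_gt_atTop 0] with N h hx
    rw [le_div_iff₀ hx]
    linarith [h.1]
  · filter_upwards [normalizedCutoff_bounds (t := t) hp0 hp1,
      (tendsto_threshold_succ_atTop t).eventually_gt_atTop 0] with N h hx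
    rw [div_le_iff₀ hx, add_mul, mul_assoc, inv_mul_cancel₀ hx.ne', one_mul, mul_one]
    exact h.2

lemma tendsto_normalizedCutoff_pow_three_div_sqrt (hp0 : 0 < p) (hp1 : p < 1) :
    Tendsto (fun N : ℕ => normalizedCutoff p t N ^ 3 / √(N : ℝ)) atTop (𝓝 0) := by
  have h := ((tendsto_normalizedCutoff_div (t := t) hp0 hp1).pow 3).mul
    (tendsto_threshold_succ_pow_three_div_sqrt t)
  rw [mul_zero] at h
  refine h.congr' ?_
  filter_upwards [(tendsto_threshold_succ_atTop t).eventually_gt_atTop 0] with N hx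
  field_simp

/-- Rounding must not disturb the Gaussian factor. A ratio tending to one would not suffice in the
exponent; here the half squares differ by at most `x / s + 1 / (2 s²)`, with `s² = N p (1 - p)`, and
`x = o(√N)`. -/
lemma tendsto_normalizedCutoff_sq_sub (hp0 : 0 < p) (hp1 : p < 1) :
    Tendsto (fun N : ℕ => normalizedCutoff p t N ^ 2 / 2 - threshold t (N + 1) ^ 2 / 2) atTop
      (𝓝 0) := by
  have hq : 0 < 1 - p := by linarith
  have hs := (tendsto_sqrt_variance_atTop hp0 hp1).inv_tendsto_atTop
  have hxs := tendsto_div_sqrt (tendsto_threshold_succ_atTop t)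
    (tendsto_threshold_succ_pow_three_div_sqrt t)
  have hb : Tendsto (fun N : ℕ => threshold t (N + 1) / √(N : ℝ) * (√(p * (1 - p)))⁻¹ +
      (√(N * p * (1 - p)))⁻¹ ^ 2 / 2) atTop (𝓝 0) := by
    simpa using (hxs.mul_const (√(p * (1 - p)))⁻¹).add ((hs.pow 2).div_const 2)
  refine squeeze_zero' ?_ ?_ hb
  · filter_upwards [normalizedCutoff_bounds (t := t) hp0 hp1,
      (tendsto_threshold_succ_atTop t).eventually_gt_atTop 0] with N h hx
    nlinarith [h.1]
  · filter_upwards [normalizedCutoff_bounds (t := t) hp0 hp1,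
      (tendsto_threshold_succ_atTop t).eventually_gt_atTop 0] with N h hx
    have e : threshold t (N + 1) / √(N : ℝ) * (√(p * (1 - p)))⁻¹ =
        threshold t (N + 1) * (√(N * p * (1 - p)))⁻¹ := by
      rw [mul_assoc (N : ℝ), Real.sqrt_mul (Nat.cast_nonneg N), mul_inv, div_eq_mul_inv, mul_assoc]
    rw [e]
    have h1 : normalizedCutoff p t N ^ 2 ≤
        (threshold t (N + 1) + (√(N * p * (1 - p)))⁻¹) ^ 2 :=
      pow_le_pow_left₀ (hx.le.trans h.1) h.2 2
    linarith

/-- The sharp asymptotics of the binomial weight at the degree cutoff. -/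
theorem tendsto_succ_mul_binomialWeight_cutoff (hp0 : 0 < p) (hp1 : p < 1) :
    Tendsto (fun N : ℕ => ((N + 1 : ℕ) : ℝ) * √(N * p * (1 - p)) *
      binomialWeight p N (degreeCutoff p t N) / normalizedCutoff p t N) atTop
      (𝓝 (Real.exp (-t))) := by
  have hM : ∀ᶠ N : ℕ in atTop, (degreeCutoff p t N : ℝ) =
      N * p + normalizedCutoff p t N * √(N * p * (1 - p)) := by
    filter_upwards [eventually_gt_atTop 0] with N hN using degreeCutoff_eq hp0 hp1 hN
  have hy3 := tendsto_normalizedCutoff_pow_three_div_sqrt (t := t) hp0 hp1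
  have hy := tendsto_normalizedCutoff_atTop (t := t) hp0 hp1
  have h1 := tendsto_binomialWeight hp0 hp1 hM (tendsto_div_sqrt hy hy3) hy3
  have h2 : Tendsto (fun N : ℕ => ((N + 1 : ℕ) : ℝ) *
      Real.exp (-(threshold t (N + 1) ^ 2 / 2)) / (√(2 * Real.pi) * threshold t (N + 1))) atTop
      (𝓝 (Real.exp (-t))) :=
    (tendsto_natCast_mul_exp_threshold t).comp (tendsto_add_atTop_nat 1)
  have h3 := (tendsto_normalizedCutoff_div (t := t) hp0 hp1).inv₀ one_ne_zero
  have h4 : Tendsto (fun N : ℕ => Real.exp (-(normalizedCutoff p t N ^ 2 / 2 -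
      threshold t (N + 1) ^ 2 / 2))) atTop (𝓝 1) := by
    have e := Real.continuous_exp.tendsto 0
    rw [Real.exp_zero] at e
    refine e.comp ?_
    simpa using (tendsto_normalizedCutoff_sq_sub (t := t) hp0 hp1).neg
  have h := ((h1.mul h2).mul h3).mul h4
  rw [inv_one, one_mul, mul_one, mul_one] at h
  refine h.congr' ?_
  filter_upwards [(tendsto_threshold_succ_atTop t).eventually_gt_atTop 0,
    hy.eventually_gt_atTop 0] with N hx hyN
  have e : Real.exp (-(normalizedCutoff p t N ^ 2 / 2 - threshold t (N + 1) ^ 2 / 2)) =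
      (Real.exp (normalizedCutoff p t N ^ 2 / 2))⁻¹ *
        (Real.exp (-(threshold t (N + 1) ^ 2 / 2)))⁻¹ := by
    rw [← Real.exp_neg, ← Real.exp_neg, ← Real.exp_add]
    congr 1
    ring
  rw [e]
  have hE1 := (Real.exp_pos (normalizedCutoff p t N ^ 2 / 2)).ne'
  have hE2 := (Real.exp_pos (-(threshold t (N + 1) ^ 2 / 2))).ne'
  field_simp

/-- The sharp asymptotics of the binomial tail at the degree cutoff. -/
theorem tendsto_succ_mul_binomial_tail_cutoff (hp0 : 0 < p) (hp1 : p < 1) :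
    Tendsto (fun N : ℕ => ((N + 1 : ℕ) : ℝ) *
      ∑ k ∈ Finset.Ico (degreeCutoff p t N) (N + 1), binomialWeight p N k) atTop
      (𝓝 (Real.exp (-t))) := by
  have hM : ∀ᶠ N : ℕ in atTop, (degreeCutoff p t N : ℝ) =
      N * p + normalizedCutoff p t N * √(N * p * (1 - p)) := by
    filter_upwards [eventually_gt_atTop 0] with N hN using degreeCutoff_eq hp0 hp1 hN
  have hy3 := tendsto_normalizedCutoff_pow_three_div_sqrt (t := t) hp0 hp1
  have hy := tendsto_normalizedCutoff_atTop (t := t) hp0 hp1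
  have h1 := tendsto_succ_mul_binomialWeight_cutoff (t := t) hp0 hp1
  have hb : ∀ᶠ N in atTop, 0 < binomialWeight p N (degreeCutoff p t N) := by
    filter_upwards [h1.eventually_const_lt (Real.exp_pos (-t))] with N h
    refine lt_of_le_of_ne (binomialWeight_nonneg hp0 hp1 _ _) fun h0 => ?_
    rw [← h0] at h
    simp at h
  have h := h1.mul (tendsto_binomial_tail_div hp0 hp1 hM hy (tendsto_div_sqrt hy hy3) hb)
  rw [mul_one] at h
  refine h.congr' ?_
  filter_upwards [hy.eventually_gt_atTop 0, hb, eventually_gt_atTop 0] with N hyN hbN hN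
  have hs := sqrt_variance_pos hp0 hp1 hN
  field_simp

end DegreeTail

/-! ### Asymptotics of the mean and of the bound, and the Poisson limit -/

variable {p : I} {t : ℝ}

lemma degreeIndicator_eq_ite (hp₀ : 0 < (p : ℝ)) (hp₁ : (p : ℝ) < 1) {N : ℕ} (hN : 0 < N)
    (hx : 0 ≤ threshold t (N + 1)) (k : ℕ) :
    degreeIndicator p t (N + 1) k = if degreeCutoff p t N ≤ k then 1 else 0 := by
  have hs := sqrt_variance_pos hp₀ hp₁ hN
  unfold degreeIndicator
  have e : (((N + 1 : ℕ) : ℝ) - 1) = N := by push_cast; ring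
  rw [e]
  refine if_congr ?_ rfl rfl
  -- The strict inequality in the exceedance matches floor plus one, even when the real cutoff is an
  -- integer.
  rw [lt_div_iff₀ hs, degreeCutoff, Nat.add_one_le_iff, Nat.floor_lt (by positivity)]
  constructor <;> intro h <;> linarith

lemma binomialMean_degreeIndicator (hp₀ : 0 < (p : ℝ)) (hp₁ : (p : ℝ) < 1) {N : ℕ} (hN : 0 < N)
    (hx : 0 ≤ threshold t (N + 1)) : binomialMean p N (degreeIndicator p t (N + 1)) =
      ∑ k ∈ Finset.Ico (degreeCutoff p t N) (N + 1), binomialWeight p N k := by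
  have h : Finset.Ico (degreeCutoff p t N) (N + 1) =
      (Finset.range (N + 1)).filter fun k => degreeCutoff p t N ≤ k := by
    ext k; simp [and_comm]
  rw [binomialMean, h, Finset.sum_filter]
  refine Finset.sum_congr rfl fun k _ => ?_
  rw [degreeIndicator_eq_ite hp₀ hp₁ hN hx, mul_ite, mul_one, mul_zero]

/-- One more edge matters only at the degree just below the cutoff, so a single weight remains.
Absorption of binomial coefficients turns it into the weight at the cutoff itself, whose asymptotics
are known, times a factor tending to one. -/
lemma binomialMean_degreeIndicator_sub (hp₀ : 0 < (p : ℝ)) (hp₁ : (p : ℝ) < 1) {m : ℕ}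
    (hx : 0 ≤ threshold t (m + 2)) :
    (binomialMean p m fun k => degreeIndicator p t (m + 2) (k + 1) - degreeIndicator p t (m + 2) k)
      = binomialWeight p (m + 1) (degreeCutoff p t (m + 1)) *
        (degreeCutoff p t (m + 1) / ((m + 1 : ℕ) * p)) := by
  have hq : (1 - p : ℝ) ≠ 0 := by linarith
  obtain ⟨c, hc⟩ : ∃ c, degreeCutoff p t (m + 1) = c + 1 := ⟨_, rfl⟩
  have h : ∀ k, degreeIndicator p t (m + 2) (k + 1) - degreeIndicator p t (m + 2) k =
      if k = c then 1 else 0 := by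
    intro k
    rw [degreeIndicator_eq_ite hp₀ hp₁ (Nat.succ_pos m) hx,
      degreeIndicator_eq_ite hp₀ hp₁ (Nat.succ_pos m) hx, hc]
    split_ifs <;> first | omega | norm_num
  have h1 : (binomialMean p m fun k =>
      degreeIndicator p t (m + 2) (k + 1) - degreeIndicator p t (m + 2) k) =
        binomialWeight p m c := by
    simp only [binomialMean, h, mul_ite, mul_one, mul_zero]
    rw [Finset.sum_ite_eq']
    split_ifs with hcm
    · rfl
    · rw [binomialWeight, Nat.choose_eq_zero_of_lt (by simpa using hcm)]
      simp
  have hch : ((m : ℝ) + 1) * m.choose c = (m + 1).choose (c + 1) * ((c : ℝ) + 1) := by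
    exact_mod_cast Nat.add_one_mul_choose_eq m c
  rw [h1, hc, binomialWeight, binomialWeight, Nat.add_sub_add_right]
  have : ((m : ℝ) + 1) ≠ 0 := by positivity
  push_cast
  field_simp
  linear_combination ((p : ℝ) ^ (c + 1)) * hch

/-- The mean number of exceedances converges. -/
theorem tendsto_meanCount (hp₀ : 0 < (p : ℝ)) (hp₁ : (p : ℝ) < 1) :
    Tendsto (fun n : ℕ => meanCount p t n) atTop (𝓝 (Real.exp (-t))) := by
  rw [← tendsto_add_atTop_iff_nat 2]
  refine ((tendsto_succ_mul_binomial_tail_cutoff (t := t) hp₀ hp₁).comp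
    (tendsto_add_atTop_nat 1)).congr' ?_
  filter_upwards [((tendsto_threshold_atTop t).comp
    (tendsto_add_atTop_nat 2)).eventually_ge_atTop 0] with m hm
  rw [meanCount_eq, binomialMean_degreeIndicator hp₀ hp₁ (Nat.succ_pos m) hm]
  rfl

lemma tendsto_natCast_mul_exceedanceProb (hp₀ : 0 < (p : ℝ)) (hp₁ : (p : ℝ) < 1) :
    Tendsto (fun m : ℕ => ((m + 2 : ℕ) : ℝ) * exceedanceProb p t (0 : Fin (m + 2))) atTop
      (𝓝 (Real.exp (-t))) := by
  refine ((tendsto_add_atTop_iff_nat 2).2 (tendsto_meanCount (t := t) hp₀ hp₁)).congr fun m => ?_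
  rw [meanCount_eq, exceedanceProb_eq]

/-- The sharp asymptotics of the covariance term of the Stein-Chen bound. -/
theorem tendsto_covariance_term (hp₀ : 0 < (p : ℝ)) (hp₁ : (p : ℝ) < 1) :
    Tendsto (fun m : ℕ => ((m + 2 : ℕ) : ℝ) / (2 * Real.log (m + 2 : ℕ)) *
      (((m + 2 : ℕ) : ℝ) * (((m + 2 : ℕ) : ℝ) - 1) *
          cov[exceedance p t (0 : Fin (m + 2)), exceedance p t (1 : Fin (m + 2));
            graphMeasure p (m + 2)] / meanCount p t (m + 2))) atTop (𝓝 (Real.exp (-t))) := by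
  have h1 := (tendsto_succ_mul_binomialWeight_cutoff (t := t) hp₀ hp₁).comp
    (tendsto_add_atTop_nat 1)
  have h2 := (tendsto_normalizedCutoff_div (t := t) hp₀ hp₁).comp (tendsto_add_atTop_nat 1)
  have h3 := (tendsto_threshold_div_sqrt_log t).comp (tendsto_add_atTop_nat 2)
  have h4 := ((tendsto_add_atTop_iff_nat 2).2 (tendsto_meanCount (t := t) hp₀ hp₁)).inv₀
    (Real.exp_pos (-t)).ne'
  have hM : ∀ᶠ N : ℕ in atTop, (degreeCutoff p t N : ℝ) =
      N * p + normalizedCutoff p t N * √(N * p * (1 - p)) := by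
    filter_upwards [eventually_gt_atTop 0] with N hN using degreeCutoff_eq hp₀ hp₁ hN
  have hy := tendsto_normalizedCutoff_atTop (t := t) hp₀ hp₁
  have h5 := ((tendsto_natCast_div_self hM (tendsto_div_sqrt hy
    (tendsto_normalizedCutoff_pow_three_div_sqrt (t := t) hp₀ hp₁))).comp
      (tendsto_add_atTop_nat 1)).div_const (p : ℝ)
  rw [div_self hp₀.ne'] at h5
  have h := ((((h1.mul h5).mul h2).mul h3).pow 2).mul h4
  have e : (Real.exp (-t) * 1 * 1 * 1) ^ 2 * (Real.exp (-t))⁻¹ = Real.exp (-t) := by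
    have := (Real.exp_pos (-t)).ne'
    field_simp
  rw [e] at h
  refine h.congr' ?_
  filter_upwards [((tendsto_threshold_atTop t).comp
      (tendsto_add_atTop_nat 2)).eventually_gt_atTop 0,
    (hy.comp (tendsto_add_atTop_nat 1)).eventually_gt_atTop 0] with m hm hym
  simp only [Function.comp_apply] at hm hym ⊢
  rw [covariance_exceedance p t (by simp), binomialMean_degreeIndicator_sub hp₀ hp₁ hm.le]
  have hlog : 0 < Real.log ((m + 2 : ℕ) : ℝ) :=
    Real.log_pos (by push_cast; linarith [(Nat.cast_nonneg m : (0 : ℝ) ≤ m)])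
  have hq : (0 : ℝ) < 1 - p := by linarith
  have hs2 : √(((m + 1 : ℕ) : ℝ) * p * (1 - p)) ^ 2 = ((m + 1 : ℕ) : ℝ) * p * (1 - p) :=
    Real.sq_sqrt (by positivity)
  have hr2 : √(2 * Real.log ((m + 2 : ℕ) : ℝ)) ^ 2 = 2 * Real.log ((m + 2 : ℕ) : ℝ) :=
    Real.sq_sqrt (by positivity)
  have e1 : (((m + 2 : ℕ) : ℝ) - 1) = ((m + 1 : ℕ) : ℝ) := by push_cast; ring
  have e2 : m + 1 + 1 = m + 2 := rfl
  rw [e1, e2]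
  have hN : ((m + 1 : ℕ) : ℝ) ≠ 0 := by positivity
  have hr : √(2 * Real.log ((m + 2 : ℕ) : ℝ)) ≠ 0 := by positivity
  have hp' := hp₀.ne'
  have hm' := hm.ne'
  have hym' := hym.ne'
  generalize √(2 * Real.log ((m + 2 : ℕ) : ℝ)) = r at *
  generalize normalizedCutoff p t (m + 1) = y at *
  generalize threshold t (m + 2) = x at *
  generalize binomialWeight p (m + 1) (degreeCutoff p t (m + 1)) = b at *
  generalize (degreeCutoff p t (m + 1) : ℝ) = M at *
  generalize √(((m + 1 : ℕ) : ℝ) * p * (1 - p)) = s at *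
  -- The auxiliary `x` and `y` cancel, and `s²` supplies the factors `n - 1` and `p (1 - p)` of the
  -- covariance term.
  have e3 : (((m + 2 : ℕ) : ℝ) * s * b / y * (M / ((m + 1 : ℕ) : ℝ) / p) * (y / x) * (x / r)) ^ 2 =
      s ^ 2 * (((m + 2 : ℕ) : ℝ) * b * (M / (((m + 1 : ℕ) : ℝ) * p)) / r) ^ 2 := by
    field_simp
  rw [← hr2, e3, hs2, div_pow]
  simp only [div_eq_mul_inv]
  ring

theorem isEquivalent_steinChenBound (hp₀ : 0 < (p : ℝ)) (hp₁ : (p : ℝ) < 1) :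
    (fun n : ℕ => steinChenBound p t n) ~[atTop]
      (fun n : ℕ => (1 + 2 * Real.log n) / n * Real.exp (-t) * (1 - Real.exp (-Real.exp (-t)))) := by
  have hc : 0 < Real.exp (-t) * (1 - Real.exp (-Real.exp (-t))) := by
    have h1 : Real.exp (-Real.exp (-t)) < 1 := by
      rw [Real.exp_lt_one_iff]; linarith [Real.exp_pos (-t)]
    have := Real.exp_pos (-t)
    exact mul_pos this (by linarith)
  have hev : ∀ᶠ n : ℕ in atTop,
      (1 + 2 * Real.log n) / n * Real.exp (-t) * (1 - Real.exp (-Real.exp (-t))) ≠ 0 := by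
    filter_upwards [tendsto_log_natCast_atTop.eventually_gt_atTop 0, eventually_gt_atTop 0]
      with n hn hpos
    have h0 : (0 : ℝ) < n := by exact_mod_cast hpos
    rw [mul_assoc]
    positivity
  refine (isEquivalent_iff_tendsto_one hev).2 ?_
  rw [← tendsto_add_atTop_iff_nat 2]
  have hl : Tendsto (fun m : ℕ => Real.log ((m + 2 : ℕ) : ℝ)) atTop atTop :=
    tendsto_log_natCast_atTop.comp (tendsto_add_atTop_nat 2)
  have hl1 : Tendsto (fun m : ℕ => (1 + 2 * Real.log ((m + 2 : ℕ) : ℝ))⁻¹) atTop (𝓝 0) :=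
    (tendsto_atTop_add_const_left _ 1 (hl.const_mul_atTop two_pos)).inv_tendsto_atTop
  have hl2 : Tendsto (fun m : ℕ => 1 - (1 + 2 * Real.log ((m + 2 : ℕ) : ℝ))⁻¹) atTop (𝓝 1) := by
    simpa using hl1.const_sub 1
  have hmean := (tendsto_add_atTop_iff_nat 2).2 (tendsto_meanCount (t := t) hp₀ hp₁)
  have hexp : Tendsto (fun m : ℕ => 1 - Real.exp (-meanCount p t (m + 2))) atTop
      (𝓝 (1 - Real.exp (-Real.exp (-t)))) :=
    ((Real.continuous_exp.tendsto _).comp hmean.neg).const_sub 1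
  -- After division by `(1 + 2 log n) / n`, the two terms of the bound carry the weights `1 / (1 + 2
  -- log n)` and `2 log n / (1 + 2 log n)`: the summand `1` matches `π_1`, and `2 log n` the
  -- covariance.
  have h := (hexp.mul (((tendsto_natCast_mul_exceedanceProb (t := t) hp₀ hp₁).mul hl1).add
    ((tendsto_covariance_term (t := t) hp₀ hp₁).mul hl2))).div_const
      (Real.exp (-t) * (1 - Real.exp (-Real.exp (-t))))
  have e : (1 - Real.exp (-Real.exp (-t))) * (Real.exp (-t) * 0 + Real.exp (-t) * 1) /
      (Real.exp (-t) * (1 - Real.exp (-Real.exp (-t)))) = 1 := by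
    rw [mul_zero, zero_add, mul_one, mul_comm, div_self hc.ne']
  rw [e] at h
  refine h.congr fun m => ?_
  have hlog : 0 < Real.log ((m + 2 : ℕ) : ℝ) :=
    Real.log_pos (by push_cast; linarith [(Nat.cast_nonneg m : (0 : ℝ) ≤ m)])
  have hn : ((m + 2 : ℕ) : ℝ) ≠ 0 := by positivity
  simp only [Pi.div_apply, steinChenBound]
  rw [mul_assoc ((1 + 2 * Real.log ((m + 2 : ℕ) : ℝ)) / ((m + 2 : ℕ) : ℝ))]
  have hc' := hc.ne'
  have hl' : 1 + 2 * Real.log ((m + 2 : ℕ) : ℝ) ≠ 0 := by positivity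
  generalize ((m + 2 : ℕ) : ℝ) * (((m + 2 : ℕ) : ℝ) - 1) *
          cov[exceedance p t (0 : Fin (m + 2)), exceedance p t (1 : Fin (m + 2));
            graphMeasure p (m + 2)] / meanCount p t (m + 2) = A at *
  generalize Real.exp (-t) * (1 - Real.exp (-Real.exp (-t))) = C at *
  field_simp
  ring

lemma isBigO_steinChenBound (hp₀ : 0 < (p : ℝ)) (hp₁ : (p : ℝ) < 1) :
    (fun n : ℕ => steinChenBound p t n) =O[atTop] (fun n : ℕ => Real.log n / n) := by
  refine (isEquivalent_steinChenBound (t := t) hp₀ hp₁).isBigO.trans ?_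
  -- The constant `3` comes from `1 + 2 log n ≤ 3 log n` once `log n ≥ 1`.
  refine IsBigO.of_bound (3 * ‖Real.exp (-t) * (1 - Real.exp (-Real.exp (-t)))‖) ?_
  filter_upwards [tendsto_log_natCast_atTop.eventually_ge_atTop 1, eventually_gt_atTop 0]
    with n hn hpos
  have h0 : (0 : ℝ) < n := by exact_mod_cast hpos
  rw [mul_assoc, norm_mul, mul_comm, mul_comm (3 : ℝ), mul_assoc]
  refine mul_le_mul_of_nonneg_left ?_ (norm_nonneg _)
  rw [Real.norm_of_nonneg (by positivity), Real.norm_of_nonneg (by positivity), ← mul_div_assoc]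
  gcongr
  linarith

lemma tvDist_nonneg (μ ν : Measure ℕ) : 0 ≤ tvDist μ ν :=
  mul_nonneg (by norm_num) (tsum_nonneg fun _ => abs_nonneg _)

theorem isBigO_poissonDistance (hp₀ : 0 < (p : ℝ)) (hp₁ : (p : ℝ) < 1) :
    (fun n : ℕ => poissonDistance p t n) =O[atTop] (fun n : ℕ => Real.log n / n) := by
  refine IsBigO.trans (IsBigO.of_bound 1 ?_) (isBigO_steinChenBound (t := t) hp₀ hp₁)
  filter_upwards [eventually_ge_atTop 2] with n hn
  rw [one_mul, poissonDistance, Real.norm_of_nonneg (tvDist_nonneg _ _)]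
  exact (poissonDistance_le_steinChenBound p t n hn).trans (le_abs_self _)

/-- The number of exceedances is asymptotically Poisson. -/
theorem tendsto_exceedanceCount (hp₀ : 0 < (p : ℝ)) (hp₁ : (p : ℝ) < 1) (k : ℕ) :
    Tendsto (fun n : ℕ => (graphMeasure p n).real {G | exceedanceCount p t n G = k}) atTop
      (𝓝 (Real.exp (-Real.exp (-t)) * (Real.exp (-(t * k)) / (k ! : ℝ)))) := by
  have hdist : Tendsto (fun n : ℕ => poissonDistance p t n) atTop (𝓝 0) := by
    refine (isBigO_poissonDistance (t := t) hp₀ hp₁).trans_tendsto ?_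
    have := (Real.isLittleO_pow_log_id_atTop (n := 1)).tendsto_div_nhds_zero.comp
      tendsto_natCast_atTop_atTop
    simpa [Function.comp_def] using this
  have hmean := tendsto_meanCount (t := t) hp₀ hp₁
  have hpoi : Tendsto (fun n : ℕ => (poissonMeasure (meanCount p t n).toNNReal).real {k}) atTop
      (𝓝 (Real.exp (-Real.exp (-t)) * (Real.exp (-(t * k)) / (k ! : ℝ)))) := by
    have h : Tendsto (fun n : ℕ => Real.exp (-meanCount p t n) * meanCount p t n ^ k / (k ! : ℝ))
        atTop (𝓝 (Real.exp (-Real.exp (-t)) * Real.exp (-t) ^ k / (k ! : ℝ))) :=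
      (((Real.continuous_exp.tendsto _).comp hmean.neg).mul (hmean.pow k)).div_const _
    rw [← Real.exp_nat_mul, mul_div_assoc, mul_neg, mul_comm (k : ℝ)] at h
    refine h.congr fun n => ?_
    rw [poissonMeasure_real_singleton, Real.coe_toNNReal _ (meanCount_nonneg p t)]
  have hdiff : Tendsto (fun n : ℕ => (countLaw p t n).real {k} -
      (poissonMeasure (meanCount p t n).toNNReal).real {k}) atTop (𝓝 0) := by
    refine squeeze_zero_norm (fun n => ?_) (by simpa using hdist.const_mul 2)
    exact abs_sub_le_tvDist (countLaw p t n) (poissonMeasure (meanCount p t n).toNNReal) k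
  have h := hdiff.add hpoi
  rw [zero_add] at h
  refine h.congr fun n => ?_
  rw [sub_add_cancel, countLaw, map_measureReal_apply .of_discrete .of_discrete]
  rfl

end RandomGraphDegrees

open RandomGraphDegrees in
theorem theorem2 (p : I) (hp₀ : 0 < (p : ℝ)) (hp₁ : (p : ℝ) < 1) (t : ℝ) :
    (∀ k : ℕ, Tendsto (fun n : ℕ => (graphMeasure p n).real {G | exceedanceCount p t n G = k}) atTop
      (𝓝 (Real.exp (-Real.exp (-t)) * (Real.exp (-(t * k)) / (k ! : ℝ))))) ∧
    Tendsto (fun n : ℕ => meanCount p t n) atTop (𝓝 (Real.exp (-t))) ∧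
    (∀ n : ℕ, 2 ≤ n → poissonDistance p t n ≤ steinChenBound p t n) ∧
    (fun n : ℕ => steinChenBound p t n) ~[atTop]
      (fun n : ℕ => (1 + 2 * Real.log n) / n * Real.exp (-t) * (1 - Real.exp (-Real.exp (-t)))) ∧
    (fun n : ℕ => poissonDistance p t n) =O[atTop] (fun n : ℕ => Real.log n / n) :=
  ⟨tendsto_exceedanceCount hp₀ hp₁, tendsto_meanCount hp₀ hp₁,
    poissonDistance_le_steinChenBound p t, isEquivalent_steinChenBound hp₀ hp₁,
    isBigO_poissonDistance hp₀ hp₁⟩
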